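/- **Problem (V-RAP).** An instance consists of a finite simple bipartite graph $G=(U\,\dot\cup\,W,E)$ (jobs $U$, machines $W$), a non-empty set $\mathcal F\subseteq W$ of vulnerable machines, and costs $c\in\mathbb R_{\ge 0}^W$. For $Y\subseteq W$ put $c(Y)=\sum_{w\in Y}c_w$. A $U$-perfect matching is a set of pairwise non-adjacent edges incident to every node of $U$. A set $X\subseteq W$ is *node-robust* if for every $f\in\mathcal F$ the graph $G[U\cup X]-\{f\}$ contains a $U$-perfect matching. The instance is *feasible* if a node-robust set exists; the task is to find a node-robust set of minimum cost. **Algorithm 1** (input: a feasible instance). 1. Put $d_e=c_w$ for each edge $e$ incident to $w\in W$ and let $M$ be a $U$-perfect matching of $G$ that minimizes $\sum_{e\in M}d_e$. 2. Let $W^M\subseteq W$ be the set of machines covered by $M$, and let $U_{\mathcal F}\subseteq U$ be the set of (critical) jobs that $M$ matches to a machine in $\mathcal F$. 3. For each $w\in W\setminus W^M$ let $R_w$ be the set of all $u\in U_{\mathcal F}$ such that $G[U\cup W^M\cup\{w\}]$ contains an $M$-alternating $u$-$w$-path (a path whose edges are alternately in $M$ and not in $M$). 4. Apply the greedy algorithm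 to the weighted set cover instance with ground set $U_{\mathcal F}$ and the family of sets $R_w$ with weights $c_w$, $w\in W\setminus W^M$: starting with $R=U_{\mathcal F}$ and $D=\emptyset$, as long as $R\ne\emptyset$ choose $w\in W\setminus W^M$ with $R_w\cap R\neq\emptyset$ that minimizes $c_w/|R_w\cap R|$, add $w$ to $D$ and replace $R$ by $R\setminus R_w$. 5. Return $X=W^M\cup D$. The choices that these steps leave open (which minimum-cost matching, how ties are broken) may be made arbitrarily. **Theorem.** Algorithm 1 is a polynomial-time $(\log|U|+2)$-approximation algorithm for V-RAP, where $\log$ is the natural logarithm (with the convention $\log 0=0$). That is: (a) On every feasible instance Algorithm 1 has a result, and every set $X$ that it can return is node-robust and satisfies $c(X)\le(\log|U|+2)\cdot c(Y)$ for every node-robust set $Y$, in particular for an optimal one. (b) There are a single program $P$ for a random access machine and a polynomial $p$ such that, for every feasible instance, $P$ halts after at most $p(|U|+|W|)$ steps with a set that Algorithm 1 can return on this instance. Here the machine has an integer memory (an elementary step can add, subtract with result at least $0$, compare, and address indirectly) and a real memory holding the costs (an elementary step can add, subtract and compare; there is no multiplication of numbers, no rounding and no real constant other than $0$), so that on rational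 costs it also runs in a polynomial number of bit operations. -/

import Mathlib

/-! ## The Node-Robust Assignment Problem -/

/-- An instance of the problem: a simple bipartite graph with job nodes `U`, machine nodes `W` and
edge set `E` (the edge between `u` and `w` is the pair `(u, w)`), a set `F` of vulnerable machines,
and a non-negative cost vector on the machines. -/
structure VRAP (U W : Type*) where
  E : Finset (U × W)
  F : Finset W
  c : W → ℝ
  c_nonneg : ∀ w, 0 ≤ c w

/-- `M` is a `U`-perfect matching of the bipartite graph with edge set `E`: a set of pairwise
non-adjacent edges that is incident to every node of `U`. -/
def IsUPerfectMatching {U W : Type*} (E M : Finset (U × W)) : Prop :=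
  M ⊆ E ∧ (∀ e ∈ M, ∀ e' ∈ M, e ≠ e' → e.1 ≠ e'.1 ∧ e.2 ≠ e'.2) ∧ ∀ u, ∃ e ∈ M, e.1 = u

/-- The simple graph on the nodes `U ⊕ W` whose edges are those in `E`. -/
def bipGraph {U W : Type*} (E : Finset (U × W)) : SimpleGraph (U ⊕ W) where
  Adj x y := ∃ e ∈ E, (x = Sum.inl e.1 ∧ y = Sum.inr e.2) ∨ (y = Sum.inl e.1 ∧ x = Sum.inr e.2)
  symm := ⟨by rintro x y ⟨e, he, h | h⟩ <;> exact ⟨e, he, by tauto⟩⟩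
  loopless := ⟨by rintro x ⟨e, -, ⟨h, h'⟩ | ⟨h, h'⟩⟩ <;> simp [h] at h'⟩

/-- A run of the greedy algorithm for weighted set cover with sets `S j` of weight `g j`, `j ∈ J`:
`GreedyRun S g J R D` says that, when the elements of `R` are still to be covered, the greedy
algorithm can go on to select exactly the sets with index in `D` and stop.  In each step it selects
a set that minimizes the weight per newly covered element (ties are broken arbitrarily). -/
inductive GreedyRun {α ι : Type*} [DecidableEq α] [DecidableEq ι]
    (S : ι → Finset α) (g : ι → ℝ) (J : Finset ι) : Finset α → Finset ι → Prop
  | done : GreedyRun S g J ∅ ∅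
  | step (R : Finset α) (D : Finset ι) (j : ι) (hj : j ∈ J) (hne : (S j ∩ R).Nonempty)
      (hmin : ∀ k ∈ J, (S k ∩ R).Nonempty →
        g j / ((S j ∩ R).card : ℝ) ≤ g k / ((S k ∩ R).card : ℝ))
      (hrun : GreedyRun S g J (R \ S j) D) :
      GreedyRun S g J R (insert j D)

namespace VRAP

variable {U W : Type*} [Fintype U] [Fintype W] [DecidableEq U] [DecidableEq W]

/-- The edge set of the subgraph `G[U ∪ X]` induced by all jobs and the machines in `X`. -/
def edgesOn (I : VRAP U W) (X : Finset W) : Finset (U × W) :=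
  I.E.filter (fun e => e.2 ∈ X)

/-- `X` is a node-robust (that is, feasible) solution: for every vulnerable machine `f`, the graph
`G[U ∪ X] - f` contains a `U`-perfect matching. -/
def NodeRobust (I : VRAP U W) (X : Finset W) : Prop :=
  ∀ f ∈ I.F, ∃ M, IsUPerfectMatching (I.edgesOn (X.erase f)) M

/-- The instance is feasible: it has a node-robust solution. -/
def Feasible (I : VRAP U W) : Prop :=
  ∃ X, I.NodeRobust X

/-- The cost of a set of machines. -/
def cost (I : VRAP U W) (X : Finset W) : ℝ :=
  ∑ w ∈ X, I.c w

/-- The cost of a set of edges with respect to the auxiliary edge costs `d (u, w) = c w`. -/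
def edgeCost (I : VRAP U W) (M : Finset (U × W)) : ℝ :=
  ∑ e ∈ M, I.c e.2

/-- `M` is a minimum-cost `U`-perfect matching of `G` with respect to `d`. -/
def IsMinCostMatching (I : VRAP U W) (M : Finset (U × W)) : Prop :=
  IsUPerfectMatching I.E M ∧ ∀ M', IsUPerfectMatching I.E M' → I.edgeCost M ≤ I.edgeCost M'

/-- `W^M`: the machines covered by `M`. -/
def matchedMachines (M : Finset (U × W)) : Finset W :=
  M.image Prod.snd

/-- `U_F`: the critical jobs, which `M` matches to a vulnerable machine. -/
def criticalJobs (I : VRAP U W) (M : Finset (U × W)) : Finset U :=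
  Finset.univ.filter (fun u => ∃ f ∈ I.F, (u, f) ∈ M)

/-- There is an `M`-alternating `u`-`w`-path in `G[U ∪ (W^M ∪ {w})]`, that is, a path whose edges
are alternately in `M` and not in `M`. -/
def HasAlternatingPath (I : VRAP U W) (M : Finset (U × W)) (u : U) (w : W) : Prop :=
  ∃ p : (bipGraph (I.edgesOn (matchedMachines M ∪ {w}))).Walk (Sum.inl u) (Sum.inr w),
    p.IsPath ∧
      p.edges.IsChain (fun e e' => e ∈ (bipGraph M).edgeSet ↔ e' ∉ (bipGraph M).edgeSet)

open Classical in
/-- `R_w`: the critical jobs from which `w` can be reached by an `M`-alternating path. -/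
noncomputable def coverSet (I : VRAP U W) (M : Finset (U × W)) (w : W) : Finset U :=
  (I.criticalJobs M).filter (fun u => I.HasAlternatingPath M u w)

/-- `X` is a possible result of the algorithm on the instance `I`: the algorithm takes a
minimum-cost `U`-perfect matching `M`, solves the set cover instance with ground set `U_F` and sets
`R_w` of weight `c w`, `w ∈ W \ W^M`, greedily, and returns `W^M` together with the machines `w` of
the selected sets `R_w`.  (The sets are a family indexed by `w`, as their weights are.) -/
def AlgorithmOutput (I : VRAP U W) (X : Finset W) : Prop :=
  ∃ (M : Finset (U × W)) (D : Finset W), I.IsMinCostMatching M ∧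
    GreedyRun (I.coverSet M) I.c (Finset.univ \ matchedMachines M) (I.criticalJobs M) D ∧
    X = matchedMachines M ∪ D

end VRAP

/-! ## Machine model

A random access machine with integer memory and real memory.  Programs are finite texts in a
structured language; elementary instructions and tests take one step each (their expressions have a
size that is fixed by the program text).  The integer memory is organized in two-dimensional arrays
and allows addition, truncated subtraction, comparison and indirect addressing.  The real memory is
organized in one-dimensional arrays and allows only addition, subtraction and comparison: there is
no multiplication, no rounding, no conversion between reals and integers and no real constant but
the content `0` of memory that has not been written.  So after `t` steps each integer has `O(t)`
more bits than the input, and each real is a combination of the input reals whose integer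
coefficients have `O(t)` bits: polynomially many steps here are also polynomially many bit
operations for rational input. -/

namespace RAM

/-- The memory: `s.nat a i j` is entry `(i, j)` of the integer array with name `a`, and
`s.real a i` is entry `i` of the real array with name `a`. -/
structure State where
  nat : ℕ → ℕ → ℕ → ℕ
  real : ℕ → ℕ → ℝ

/-- Integer expressions. -/
inductive NExp
  | const (k : ℕ)
  | get (a : ℕ) (i j : NExp)
  | add (x y : NExp)
  | sub (x y : NExp)

/-- Real expressions. -/
inductive RExp
  | get (a : ℕ) (i : NExp)
  | add (x y : RExp)
  | sub (x y : RExp)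

/-- Tests. -/
inductive Test
  | natEq (x y : NExp)
  | natLt (x y : NExp)
  | realLt (x y : RExp)
  | neg (b : Test)
  | conj (b b' : Test)

/-- Programs. -/
inductive Cmd
  | skip
  | setNat (a : ℕ) (i j x : NExp)
  | setReal (a : ℕ) (i : NExp) (x : RExp)
  | seq (p q : Cmd)
  | cond (b : Test) (p q : Cmd)
  | loop (b : Test) (p : Cmd)

/-- The value of an integer expression. -/
def NExp.eval (s : State) : NExp → ℕ
  | .const k => k
  | .get a i j => s.nat a (i.eval s) (j.eval s)
  | .add x y => x.eval s + y.eval s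
  | .sub x y => x.eval s - y.eval s

/-- The value of a real expression. -/
def RExp.eval (s : State) : RExp → ℝ
  | .get a i => s.real a (i.eval s)
  | .add x y => x.eval s + y.eval s
  | .sub x y => x.eval s - y.eval s

/-- The truth value of a test. -/
def Test.Holds (s : State) : Test → Prop
  | .natEq x y => x.eval s = y.eval s
  | .natLt x y => x.eval s < y.eval s
  | .realLt x y => x.eval s < y.eval s
  | .neg b => ¬ b.Holds s
  | .conj b b' => b.Holds s ∧ b'.Holds s

/-- The memory after writing `v` to entry `(i, j)` of the integer array `a`. -/
def State.writeNat (s : State) (a i j v : ℕ) : State :=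
  { s with nat := fun a' i' j' => if a' = a ∧ i' = i ∧ j' = j then v else s.nat a' i' j' }

/-- The memory after writing `v` to entry `i` of the real array `a`. -/
noncomputable def State.writeReal (s : State) (a i : ℕ) (v : ℝ) : State :=
  { s with real := fun a' i' => if a' = a ∧ i' = i then v else s.real a' i' }

/-- `Exec p s t s'`: the program `p`, started with memory `s`, halts after exactly `t` steps with
memory `s'`.  Each assignment and each evaluation of a test is a step. -/
inductive Exec : Cmd → State → ℕ → State → Prop
  | skip (s : State) : Exec .skip s 1 s
  | setNat (s : State) (a : ℕ) (i j x : NExp) :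
      Exec (.setNat a i j x) s 1 (s.writeNat a (i.eval s) (j.eval s) (x.eval s))
  | setReal (s : State) (a : ℕ) (i : NExp) (x : RExp) :
      Exec (.setReal a i x) s 1 (s.writeReal a (i.eval s) (x.eval s))
  | seq (p q : Cmd) (s s' s'' : State) (t t' : ℕ) (hp : Exec p s t s') (hq : Exec q s' t' s'') :
      Exec (.seq p q) s (t + t') s''
  | condTrue (b : Test) (p q : Cmd) (s s' : State) (t : ℕ) (hb : b.Holds s) (hp : Exec p s t s') :
      Exec (.cond b p q) s (1 + t) s'
  | condFalse (b : Test) (p q : Cmd) (s s' : State) (t : ℕ) (hb : ¬ b.Holds s)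
      (hq : Exec q s t s') : Exec (.cond b p q) s (1 + t) s'
  | loopFalse (b : Test) (p : Cmd) (s : State) (hb : ¬ b.Holds s) : Exec (.loop b p) s 1 s
  | loopTrue (b : Test) (p : Cmd) (s s' s'' : State) (t t' : ℕ) (hb : b.Holds s)
      (hp : Exec p s t s') (hl : Exec (.loop b p) s' t' s'') :
      Exec (.loop b p) s (1 + t + t') s''

/-- The initial memory for an instance with jobs `0, …, m - 1` and machines `0, …, n - 1`: integer
arrays `0` and `1` hold `m` and `n` in entry `(0, 0)`, integer array `2` is the adjacency matrix,
integer array `3` marks the vulnerable machines in column `0`, real array `0` is the cost vector.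
All other entries are zero. -/
def initial {m n : ℕ} (I : VRAP (Fin m) (Fin n)) : State where
  nat a i j :=
    if a = 0 ∧ i = 0 ∧ j = 0 then m
    else if a = 1 ∧ i = 0 ∧ j = 0 then n
    else if a = 2 ∧ (∃ e ∈ I.E, e.1.val = i ∧ e.2.val = j) then 1
    else if a = 3 ∧ j = 0 ∧ (∃ f ∈ I.F, f.val = i) then 1
    else 0
  real a i := if h : a = 0 ∧ i < n then I.c ⟨i, h.2⟩ else 0

/-- The set of machines that a final memory describes: those marked by `1` in column `0` of integer
array `4`. -/
def output (n : ℕ) (s : State) : Finset (Fin n) :=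
  Finset.univ.filter (fun w => s.nat 4 w.val 0 = 1)

end RAM

/-! ## Matchings as injections -/

section Matching

variable {U W : Type*}

/-! Approximation. Let `Y` be node-robust. As `F` is non-empty, `Y` contains the machines of some
`U`-perfect matching, so `W^M` costs at most `c(Y)`. Moreover `Y \ W^M` is a set cover: if a job `u`
is matched to `f ∈ F`, a matching inside `Y` that avoids `f` forces an alternating walk from some
machine of `Y \ W^M` to `u` (`exists_altReach_of_avoids`, `VRAP.exists_cover`). The usual pricing
argument for greedy set cover (`GreedyRun.sum_le`) bounds the cost of `D` by the harmonic number of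
`|U_F|` times `c(Y)`, that is, by `(1 + log |U|) c(Y)`. The two bounds add up to `log |U| + 2`.
Conversely, exchanging `M` along an alternating walk of minimal length frees the machine of `u` at
the price of one new machine (`AltReach.exists_exchange`), so the result is node-robust. Alternating
paths are replaced by the inductive relation `AltReach`; the two notions agree for a free machine
(`mem_coverSet_iff`).

Running time. Edge costs depend only on the machine, so a minimum-cost perfect matching is a
minimum-cost basis of a transversal matroid. The program tries the machines in the order of cost and
keeps a machine if it can be added by an augmenting path; covered machines stay covered. Optimality
needs no potentials: each rejected machine has a closed set of machines that are no more expensive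
and that absorb all their neighbours (`IsLocallyOptimal`). A counting argument at every cost
threshold compares the result with an arbitrary perfect matching (`card_superlevel_le`), and
integration over the threshold compares the costs. Closed sets survive later augmentations, because
an augmenting path never touches them (`Hole.closed`).

The cover phase counts newly reached jobs and compares the ratios `c_w / |R_w ∩ R|` after
cross-multiplication, with products formed by repeated addition. All loops are bounded by the number
of jobs or of machines. Hence programs have a total denotation `den`, about which invariants are
proved, and a polynomial `timeBound`, read off the syntax; `Prog.exec` connects both with the step
semantics. -/

theorem IsUPerfectMatching.exists_fun {E M : Finset (U × W)} (h : IsUPerfectMatching E M) :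
    ∃ g : U → W, Function.Injective g ∧ (∀ u, (u, g u) ∈ E) ∧ ∀ u w, (u, w) ∈ M ↔ w = g u := by
  have hex : ∀ u, ∃ w, (u, w) ∈ M := by
    intro u
    obtain ⟨⟨a, b⟩, he, rfl⟩ := h.2.2 u
    exact ⟨b, he⟩
  choose g hg using hex
  refine ⟨g, ?_, fun u => h.1 (hg u), fun u w => ⟨fun hw => ?_, fun hw => hw ▸ hg u⟩⟩
  · intro u v huv
    by_contra hne
    exact (h.2.1 _ (hg u) _ (hg v) (fun he => hne (congrArg Prod.fst he))).2 huv
  · by_contra hne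
    exact (h.2.1 _ hw _ (hg u) (fun he => hne (congrArg Prod.snd he))).1 rfl

theorem isUPerfectMatching_image [Fintype U] [DecidableEq U] [DecidableEq W]
    {E : Finset (U × W)} {g : U → W} (hg : Function.Injective g) (hE : ∀ u, (u, g u) ∈ E) :
    IsUPerfectMatching E (Finset.univ.image fun u => (u, g u)) := by
  refine ⟨?_, ?_, fun u => ⟨(u, g u), by simp, rfl⟩⟩
  · intro e he
    obtain ⟨u, -, rfl⟩ := Finset.mem_image.1 he
    exact hE u
  · intro e he e' he' hne
    obtain ⟨u, -, rfl⟩ := Finset.mem_image.1 he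
    obtain ⟨v, -, rfl⟩ := Finset.mem_image.1 he'
    have huv : u ≠ v := fun h => hne (by rw [h])
    exact ⟨huv, fun h => huv (hg h)⟩

/-- The jobs that can be reached from the machine `w` by walks that alternate between edges of `E`
(from machines to jobs) and edges of `M` (from jobs to machines). -/
inductive AltReach (E M : Finset (U × W)) (w : W) : U → Prop
  | base {u : U} (h : (u, w) ∈ E) : AltReach E M w u
  | step {u v : U} {x : W} (hv : AltReach E M w v) (hM : (v, x) ∈ M) (hE : (u, x) ∈ E) :
      AltReach E M w u

/-- The jobs that are reached by alternating walks with at most `k` edges of `M`. -/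
def AltLevel (E M : Finset (U × W)) (w : W) : ℕ → U → Prop
  | 0, u => (u, w) ∈ E
  | k + 1, u => AltLevel E M w k u ∨ ∃ v x, AltLevel E M w k v ∧ (v, x) ∈ M ∧ (u, x) ∈ E

theorem AltLevel.altReach {E M : Finset (U × W)} {w : W} {k : ℕ} {u : U}
    (h : AltLevel E M w k u) : AltReach E M w u := by
  induction k generalizing u with
  | zero => exact .base h
  | succ k ih =>
    rcases h with h | ⟨v, x, hv, hM, hE⟩
    · exact ih h
    · exact .step (ih hv) hM hE

theorem AltReach.exists_altLevel {E M : Finset (U × W)} {w : W} {u : U}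
    (h : AltReach E M w u) : ∃ k, AltLevel E M w k u := by
  induction h with
  | base h => exact ⟨0, h⟩
  | step hv hM hE ih =>
    obtain ⟨k, hk⟩ := ih
    exact ⟨k + 1, Or.inr ⟨_, _, hk, hM, hE⟩⟩

/-- The rank is the least number of matching edges on an alternating walk to `u`. Inductions along a
chain of strictly decreasing rank play the part of inductions along a shortest path, which cannot
repeat a job. -/
theorem AltReach.exists_rank (E M : Finset (U × W)) (w : W) :
    ∃ r : U → ℕ, ∀ u, AltReach E M w u → (u, w) ∈ E ∨
      ∃ v x, AltReach E M w v ∧ (v, x) ∈ M ∧ (u, x) ∈ E ∧ r v < r u := by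
  refine ⟨fun u => sInf {k | AltLevel E M w k u}, fun u hu => ?_⟩
  have hmem : AltLevel E M w (sInf {k | AltLevel E M w k u}) u :=
    Nat.sInf_mem (s := {k | AltLevel E M w k u}) hu.exists_altLevel
  rcases hk : sInf {k | AltLevel E M w k u} with _ | k
  · rw [hk] at hmem
    exact Or.inl hmem
  · rw [hk] at hmem
    rcases hmem with h | ⟨v, x, hv, hM, hE⟩
    · have := Nat.sInf_le (s := {k | AltLevel E M w k u}) h
      omega
    · refine Or.inr ⟨v, x, hv.altReach, hM, hE, ?_⟩
      have := Nat.sInf_le (s := {k | AltLevel E M w k v}) hv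
      simp only [hk]
      omega

/-- Exchanging a matching along an alternating walk of minimal length from `w` to `u` frees the
machine of `u`. -/
theorem AltReach.exists_exchange [DecidableEq U] {E M : Finset (U × W)} {w : W} {g : U → W}
    (hg : Function.Injective g) (hE : ∀ u, (u, g u) ∈ E) (hM : ∀ u x, (u, x) ∈ M ↔ x = g u)
    (hw : ∀ u, g u ≠ w) {u : U} (h : AltReach E M w u) :
    ∃ f : U → W, Function.Injective f ∧ (∀ v, (v, f v) ∈ E) ∧
      (∀ v, f v = w ∨ ∃ v', f v = g v') ∧ ∀ v, f v ≠ g u := by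
  obtain ⟨r, hr⟩ := AltReach.exists_rank E M w
  -- The induction also carries that jobs of rank above `r u` keep their machine. So the next job
  -- `u` on the walk still has `g u` when it moves to the machine `g v` just freed.
  suffices H : ∀ k u, r u = k → AltReach E M w u →
      ∃ f : U → W, Function.Injective f ∧ (∀ v, (v, f v) ∈ E) ∧
        (∀ v, f v = w ∨ ∃ v', f v = g v') ∧ (∀ v, f v ≠ g u) ∧ ∀ v, r u < r v → f v = g v by
    obtain ⟨f, h1, h2, h3, h4, -⟩ := H _ u rfl h
    exact ⟨f, h1, h2, h3, h4⟩
  have key : ∀ (f : U → W) (u : U) (x : W), Function.Injective f → f u = g u →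
      (∀ v, f v ≠ x) → Function.Injective (Function.update f u x) ∧ (x ≠ g u →
        ∀ v, Function.update f u x v ≠ g u) := by
    intro f u x hf hfu hx
    refine ⟨?_, fun hxu v => ?_⟩
    · intro a b hab
      by_cases ha : a = u <;> by_cases hb : b = u
      · rw [ha, hb]
      · subst ha
        rw [Function.update_self, Function.update_of_ne hb] at hab
        exact absurd hab.symm (hx b)
      · subst hb
        rw [Function.update_self, Function.update_of_ne ha] at hab
        exact absurd hab (hx a)
      · rw [Function.update_of_ne ha, Function.update_of_ne hb] at hab
        exact hf hab
    · by_cases hv : v = u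
      · subst hv
        rwa [Function.update_self]
      · rw [Function.update_of_ne hv, ← hfu]
        exact fun h => hv (hf h)
  intro k
  induction k using Nat.strong_induction_on with
  | _ k ih =>
    intro u hk hu
    rcases hr u hu with hb | ⟨v, x, hv, hvx, hux, hlt⟩
    · obtain ⟨h1, h2⟩ := key g u w hg rfl hw
      refine ⟨Function.update g u w, h1, fun v => ?_, fun v => ?_, h2 (hw u).symm, fun v hv => ?_⟩
      · by_cases hv : v = u
        · subst hv; rwa [Function.update_self]
        · rw [Function.update_of_ne hv]; exact hE v
      · by_cases hv : v = u
        · subst hv; left; rw [Function.update_self]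
        · right; exact ⟨v, Function.update_of_ne hv _ _⟩
      · exact Function.update_of_ne (by rintro rfl; omega) _ _
    · obtain ⟨f, f1, f2, f3, f4, f5⟩ := ih (r v) (hk ▸ hlt) v rfl hv
      have hx := (hM _ _).1 hvx
      subst hx
      have hne : u ≠ v := by rintro rfl; omega
      obtain ⟨h1, h2⟩ := key f u (g v) f1 (f5 u hlt) f4
      refine ⟨Function.update f u (g v), h1, fun z => ?_, fun z => ?_,
        h2 (fun h => hne (hg h).symm), fun z hz => ?_⟩
      · by_cases hz : z = u
        · subst hz; rwa [Function.update_self]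
        · rw [Function.update_of_ne hz]; exact f2 z
      · by_cases hz : z = u
        · subst hz; right; exact ⟨v, Function.update_self _ _ _⟩
        · rw [Function.update_of_ne hz]; exact f3 z
      · rw [Function.update_of_ne (by rintro rfl; omega)]
        exact f5 z (by omega)

/-- If a second matching avoids the machine of `u`, then `u` can be reached from a machine that only
the second matching covers. -/
theorem exists_altReach_of_avoids [Finite U] {E M : Finset (U × W)} {g f : U → W}
    (hM : ∀ u x, (u, x) ∈ M ↔ x = g u) (hf : Function.Injective f) (hfE : ∀ u, (u, f u) ∈ E)
    {u : U} (hu : ∀ v, f v ≠ g u) :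
    ∃ v, (∀ v', g v' ≠ f v) ∧ AltReach E M (f v) u := by
  -- If `u` lay outside `C`, then `f` would send each job outside `C` to a machine that `g` gives to
  -- a job outside `C`. This defines an injective self-map of a finite set, hence a surjective one,
  -- and so `f` would use the machine `g u`.
  let C : Set U := {z | ∃ v, (∀ v', g v' ≠ f v) ∧ AltReach E M (f v) z}
  by_contra hcon
  have huC : u ∉ C := hcon
  have hex : ∀ z : {z // z ∉ C}, ∃ z' : {z // z ∉ C}, g z' = f z := by
    rintro ⟨z, hz⟩
    by_cases hm : ∃ z', g z' = f z
    · obtain ⟨z', hz'⟩ := hm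
      refine ⟨⟨z', ?_⟩, hz'⟩
      rintro ⟨v, hv, hr⟩
      exact hz ⟨v, hv, hr.step ((hM _ _).2 hz'.symm) (hfE z)⟩
    · push Not at hm
      exact absurd ⟨z, hm, .base (hfE z)⟩ hz
  choose s hs using hex
  have hinj : Function.Injective s := by
    intro a b hab
    have := hs a
    rw [hab, hs b] at this
    exact Subtype.ext (hf this.symm)
  obtain ⟨z, hz⟩ := Finite.injective_iff_surjective.1 hinj ⟨u, huC⟩
  have := hs z
  rw [hz] at this
  exact hu z this.symm

end Matching

/-! ## The greedy algorithm for set cover -/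

section Greedy

variable {α ι : Type*} [DecidableEq α] [DecidableEq ι]

/-- Each of the `a` terms of the harmonic sum beyond the `b`-th is at least `1 / (b + a)`. -/
theorem harmonic_add_sub_ge (a b : ℕ) :
    ((a : ℝ) / ((b + a : ℕ) : ℝ)) ≤ (harmonic (b + a) : ℝ) - (harmonic b : ℝ) := by
  induction a with
  | zero => simp
  | succ a ih =>
    rw [← add_assoc, harmonic_succ]
    push_cast at ih ⊢
    have h1 : (a : ℝ) / (b + a + 1) ≤ a / (b + a) := by
      rcases Nat.eq_zero_or_pos a with rfl | ha
      · simp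
      · have : (0 : ℝ) < a := by exact_mod_cast ha
        exact div_le_div_of_nonneg_left this.le (by positivity) (by linarith)
    have h2 : ((a : ℝ) + 1) / (b + a + 1) = a / (b + a + 1) + (b + a + 1 : ℝ)⁻¹ := by
      rw [add_div, one_div]
    linarith

theorem exists_greedyRun (S : ι → Finset α) (g : ι → ℝ) (J : Finset ι) (R : Finset α)
    (hR : ∀ a ∈ R, ∃ j ∈ J, a ∈ S j) : ∃ D, GreedyRun S g J R D := by
  induction R using Finset.strongInduction with
  | H R ih =>
    rcases R.eq_empty_or_nonempty with rfl | ⟨a, ha⟩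
    · exact ⟨∅, .done⟩
    · obtain ⟨j₀, hj₀, haj⟩ := hR a ha
      obtain ⟨j, hj, hmin⟩ := Finset.exists_min_image (J.filter fun k => (S k ∩ R).Nonempty)
        (fun k => g k / ((S k ∩ R).card : ℝ))
        ⟨j₀, Finset.mem_filter.2 ⟨hj₀, a, Finset.mem_inter.2 ⟨haj, ha⟩⟩⟩
      rw [Finset.mem_filter] at hj
      obtain ⟨D, hD⟩ := ih (R \ S j) (by
        refine Finset.ssubset_iff_subset_ne.2 ⟨Finset.sdiff_subset, fun h => ?_⟩
        obtain ⟨b, hb⟩ := hj.2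
        rw [Finset.mem_inter] at hb
        have := hb.2
        rw [← h] at this
        exact (Finset.mem_sdiff.1 this).2 hb.1)
        (fun b hb => hR b (Finset.mem_sdiff.1 hb).1)
      exact ⟨_, .step R D j hj.1 hj.2 (fun k hk hne => hmin k (Finset.mem_filter.2 ⟨hk, hne⟩)) hD⟩

theorem GreedyRun.exists_mem {S : ι → Finset α} {g : ι → ℝ} {J : Finset ι} {R : Finset α}
    {D : Finset ι} (h : GreedyRun S g J R D) {a : α} (ha : a ∈ R) :
    ∃ j ∈ D, j ∈ J ∧ a ∈ S j := by
  induction h with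
  | done => simp at ha
  | step R D j hj hne hmin hrun ih =>
    by_cases haj : a ∈ S j
    · exact ⟨j, Finset.mem_insert_self _ _, hj, haj⟩
    · obtain ⟨k, hk, hk'⟩ := ih (Finset.mem_sdiff.2 ⟨ha, haj⟩)
      exact ⟨k, Finset.mem_insert_of_mem hk, hk'⟩

/-- Let `q` be the price per element in the current step. Each set of the cover `T` pays at least
`q` per element of `R` that it contains, so `q * |R|` is at most the weight of `T`. The step
therefore costs at most the fraction of `R` newly covered times that weight, which
`harmonic_add_sub_ge` bounds by a difference of harmonic numbers; these differences telescope, as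
`T` also covers what remains. -/
theorem GreedyRun.sum_le {S : ι → Finset α} {g : ι → ℝ} {J : Finset ι} {R : Finset α}
    {D : Finset ι} (hg : ∀ j, 0 ≤ g j) (h : GreedyRun S g J R D) {T : Finset ι} (hT : T ⊆ J)
    (hcov : ∀ a ∈ R, ∃ k ∈ T, a ∈ S k) :
    ∑ j ∈ D, g j ≤ (harmonic R.card : ℝ) * ∑ k ∈ T, g k := by
  induction h with
  | done => simp
  | step R D j hj hne hmin hrun ih =>
    have ih' := ih (fun a ha => hcov a (Finset.mem_sdiff.1 ha).1)
    have hins : ∑ k ∈ insert j D, g k ≤ g j + ∑ k ∈ D, g k := by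
      by_cases hjD : j ∈ D
      · rw [Finset.insert_eq_of_mem hjD]
        linarith [hg j]
      · rw [Finset.sum_insert hjD]
    have hcard : (R \ S j).card + (S j ∩ R).card = R.card := by
      rw [Finset.inter_comm, Finset.card_sdiff_add_card_inter]
    have hpos : 0 < (S j ∩ R).card := hne.card_pos
    set q := g j / ((S j ∩ R).card : ℝ) with hq
    have hq0 : 0 ≤ q := by have := hg j; positivity
    have hprice : q * R.card ≤ ∑ k ∈ T, g k := by
      have h1 : R.card ≤ ∑ k ∈ T, (S k ∩ R).card := by
        refine (Finset.card_le_card (t := T.biUnion fun k => S k ∩ R) ?_).trans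
          Finset.card_biUnion_le
        intro a ha
        obtain ⟨k, hk, hak⟩ := hcov a ha
        exact Finset.mem_biUnion.2 ⟨k, hk, Finset.mem_inter.2 ⟨hak, ha⟩⟩
      calc q * R.card ≤ q * ∑ k ∈ T, ((S k ∩ R).card : ℝ) := by
            gcongr
            exact_mod_cast h1
        _ = ∑ k ∈ T, q * ((S k ∩ R).card : ℝ) := Finset.mul_sum _ _ _
        _ ≤ ∑ k ∈ T, g k := by
            refine Finset.sum_le_sum fun k hk => ?_
            rcases (S k ∩ R).eq_empty_or_nonempty with he | hne'
            · simp [he, hg k]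
            · have hk0 : (0 : ℝ) < (S k ∩ R).card := by exact_mod_cast hne'.card_pos
              have := hmin k (hT hk) hne'
              rwa [le_div_iff₀ hk0] at this
    have hR0 : (0 : ℝ) < R.card := by exact_mod_cast (by omega : 0 < R.card)
    have hS0 : (0 : ℝ) < (S j ∩ R).card := by exact_mod_cast hpos
    have hT0 : 0 ≤ ∑ k ∈ T, g k := Finset.sum_nonneg fun k _ => hg k
    have hgj : g j ≤ ((S j ∩ R).card : ℝ) / R.card * ∑ k ∈ T, g k := by
      calc g j = ((S j ∩ R).card : ℝ) / R.card * (q * R.card) := by rw [hq]; field_simp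
        _ ≤ ((S j ∩ R).card : ℝ) / R.card * ∑ k ∈ T, g k := by gcongr
    have hh := harmonic_add_sub_ge (S j ∩ R).card (R \ S j).card
    rw [hcard] at hh
    nlinarith [mul_le_mul_of_nonneg_right hh hT0]

end Greedy

/-! ## Alternating paths -/

section AlternatingPath

set_option linter.unusedSectionVars false

variable {U W : Type*} [Fintype U] [Fintype W] [DecidableEq U] [DecidableEq W]

@[simp]
theorem bipGraph_adj_inl_inr {E : Finset (U × W)} {u : U} {w : W} :
    (bipGraph E).Adj (Sum.inl u) (Sum.inr w) ↔ (u, w) ∈ E := by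
  constructor
  · rintro ⟨⟨a, b⟩, he, ⟨h1, h2⟩ | ⟨h1, h2⟩⟩
    · rw [Sum.inl.injEq] at h1
      rw [Sum.inr.injEq] at h2
      subst h1 h2
      exact he
    · simp at h1
  · exact fun h => ⟨_, h, Or.inl ⟨rfl, rfl⟩⟩

@[simp]
theorem bipGraph_adj_inr_inl {E : Finset (U × W)} {u : U} {w : W} :
    (bipGraph E).Adj (Sum.inr w) (Sum.inl u) ↔ (u, w) ∈ E := by
  rw [SimpleGraph.adj_comm, bipGraph_adj_inl_inr]

@[simp]
theorem not_bipGraph_adj_inl_inl {E : Finset (U × W)} {u v : U} :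
    ¬ (bipGraph E).Adj (Sum.inl u) (Sum.inl v) := by
  rintro ⟨e, -, ⟨-, h⟩ | ⟨-, h⟩⟩ <;> simp at h

@[simp]
theorem not_bipGraph_adj_inr_inr {E : Finset (U × W)} {u v : W} :
    ¬ (bipGraph E).Adj (Sum.inr u) (Sum.inr v) := by
  rintro ⟨e, -, ⟨h, -⟩ | ⟨h, -⟩⟩ <;> simp at h

namespace VRAP

variable {I : VRAP U W} {M : Finset (U × W)}

theorem mem_edgesOn {X : Finset W} {u : U} {w : W} :
    (u, w) ∈ I.edgesOn X ↔ (u, w) ∈ I.E ∧ w ∈ X := by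
  simp [edgesOn]

/-- The last edge meets the free machine `w`, so it is not in `M`. Alternation propagates this
backwards: edges leaving a job are outside `M`, edges leaving a machine are in `M`. The membership
of the first edge is part of the conclusion because the induction needs it. -/
theorem altReach_of_walk {w : W} (hw : w ∉ matchedMachines M) {a b : U ⊕ W}
    (p : (bipGraph (I.edgesOn (matchedMachines M ∪ {w}))).Walk a b) (hb : b = Sum.inr w)
    (hp : p.edges.IsChain fun e e' => e ∈ (bipGraph M).edgeSet ↔ e' ∉ (bipGraph M).edgeSet) :
    (∀ u, a = Sum.inl u → AltReach I.E M w u ∧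
      ∀ e ∈ p.edges.head?, e ∉ (bipGraph M).edgeSet) ∧
    ∀ x, a = Sum.inr x → x = w ∨ ∃ u, (u, x) ∈ M ∧ AltReach I.E M w u ∧
      ∀ e ∈ p.edges.head?, e ∈ (bipGraph M).edgeSet := by
  have hfree : ∀ u, (u, w) ∉ M := fun u hu => hw (Finset.mem_image.2 ⟨_, hu, rfl⟩)
  induction p with
  | nil =>
    subst hb
    refine ⟨by simp, fun x hx => Or.inl ?_⟩
    simpa using hx.symm
  | @cons a c b hadj p ih =>
    rw [SimpleGraph.Walk.edges_cons, List.isChain_cons] at hp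
    obtain ⟨ih1, ih2⟩ := ih hb hp.2
    have hhead : ∀ e ∈ p.edges.head?, (s(a, c) ∈ (bipGraph M).edgeSet ↔
      e ∉ (bipGraph M).edgeSet) := hp.1
    have hlast : p.edges.head? = none → c = b := by
      intro h
      cases p with
      | nil => rfl
      | cons h' p' => simp at h
    simp only [SimpleGraph.Walk.edges_cons, List.head?_cons, Option.mem_some_iff, forall_eq']
    refine ⟨?_, ?_⟩
    · rintro u rfl
      rcases c with v | x
      · exact absurd hadj not_bipGraph_adj_inl_inl
      · have hux := (mem_edgesOn.1 (bipGraph_adj_inl_inr.1 hadj)).1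
        rcases ih2 x rfl with rfl | ⟨v, hv, hr, hh⟩
        · exact ⟨.base hux, by simpa using hfree u⟩
        · refine ⟨hr.step hv hux, ?_⟩
          rcases hh' : p.edges.head? with _ | e
          · have := hlast hh'
            rw [hb, Sum.inr.injEq] at this
            subst this
            exact absurd hv (hfree v)
          · rw [hh'] at hhead hh
            have h1 := hhead e rfl
            have h2 := hh e rfl
            tauto
    · rintro x rfl
      rcases c with v | y
      · right
        obtain ⟨hr, hh⟩ := ih1 v rfl
        have hmem : s(Sum.inr x, Sum.inl v) ∈ (bipGraph M).edgeSet := by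
          rcases hh' : p.edges.head? with _ | e
          · have := hlast hh'
            rw [hb] at this
            simp at this
          · rw [hh'] at hhead hh
            exact (hhead e rfl).2 (hh e rfl)
        exact ⟨v, by simpa using hmem, hr, hmem⟩
      · exact absurd hadj not_bipGraph_adj_inr_inr

/-- The walk is built along decreasing rank. The bounds on the ranks of the jobs on the walk, and of
the jobs matched to its machines, show that the two nodes put in front are new, so that the walk is
a path. -/
theorem exists_walk_of_altReach {w : W} (hw : w ∉ matchedMachines M) {g : U → W}
    (hg : Function.Injective g) (hgE : ∀ u, (u, g u) ∈ I.E)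
    (hM : ∀ u x, (u, x) ∈ M ↔ x = g u) {u : U}
    (h : AltReach I.E M w u) : I.HasAlternatingPath M u w := by
  have hfree : ∀ u, (u, w) ∉ M := fun u hu => hw (Finset.mem_image.2 ⟨_, hu, rfl⟩)
  obtain ⟨r, hr⟩ := AltReach.exists_rank I.E M w
  suffices H : ∀ k u, r u = k → AltReach I.E M w u →
      ∃ p : (bipGraph (I.edgesOn (matchedMachines M ∪ {w}))).Walk (Sum.inl u) (Sum.inr w),
        p.IsPath ∧
        p.edges.IsChain (fun e e' => e ∈ (bipGraph M).edgeSet ↔ e' ∉ (bipGraph M).edgeSet) ∧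
        (∀ e ∈ p.edges.head?, e ∉ (bipGraph M).edgeSet) ∧
        (∀ v, Sum.inl v ∈ p.support → r v ≤ r u) ∧
        ∀ x, Sum.inr x ∈ p.support → x = w ∨ ∃ v, (v, x) ∈ M ∧ r v < r u by
    obtain ⟨p, h1, h2, -⟩ := H _ u rfl h
    exact ⟨p, h1, h2⟩
  intro k
  induction k using Nat.strong_induction_on with
  | _ k ih =>
    intro u hk hu
    rcases hr u hu with hb | ⟨v, x, hv, hvx, hux, hlt⟩
    · have hadj : (bipGraph (I.edgesOn (matchedMachines M ∪ {w}))).Adj (Sum.inl u) (Sum.inr w) := by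
        simp [mem_edgesOn, hb]
      refine ⟨.cons hadj .nil, by simp, by simp, by simpa using hfree u, ?_, ?_⟩
      · intro v hv
        simp at hv
        rw [hv]
      · intro x hx
        simp at hx
        exact Or.inl hx
    · obtain ⟨p, h1, h2, h3, h4, h5⟩ := ih (r v) (hk ▸ hlt) v rfl hv
      have hxm : x ∈ matchedMachines M := Finset.mem_image.2 ⟨_, hvx, rfl⟩
      have huM : (u, x) ∉ M := by
        intro hu'
        have e1 := (hM _ _).1 hu'
        have e2 := (hM _ _).1 hvx
        have := hg (e1.symm.trans e2)
        subst this
        omega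
      have hvE : (v, x) ∈ I.E := (hM _ _).1 hvx ▸ hgE v
      have a1 : (bipGraph (I.edgesOn (matchedMachines M ∪ {w}))).Adj (Sum.inl u) (Sum.inr x) := by
        simp [mem_edgesOn, hux, hxm]
      have a2 : (bipGraph (I.edgesOn (matchedMachines M ∪ {w}))).Adj (Sum.inr x) (Sum.inl v) := by
        simp [mem_edgesOn, hvE, hxm]
      have hxp : Sum.inr x ∉ p.support := by
        intro hx
        rcases h5 x hx with rfl | ⟨z, hz, hzr⟩
        · exact hw hxm
        · have := hg (((hM _ _).1 hz).symm.trans ((hM _ _).1 hvx))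
          subst this
          omega
      have hup : Sum.inl u ∉ p.support := fun h => by have := h4 u h; omega
      refine ⟨.cons a1 (.cons a2 p), ?_, ?_, by simpa using huM, ?_, ?_⟩
      · simp [SimpleGraph.Walk.cons_isPath_iff, h1, hxp, hup]
      · rw [SimpleGraph.Walk.edges_cons, SimpleGraph.Walk.edges_cons, List.isChain_cons,
          List.isChain_cons]
        refine ⟨?_, ?_, h2⟩
        · simp [hvx, huM]
        · intro e he
          have := h3 e he
          simp [hvx, this]
      · intro z hz
        simp only [SimpleGraph.Walk.support_cons, List.mem_cons, Sum.inl.injEq, reduceCtorEq,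
          false_or] at hz
        rcases hz with rfl | hz
        · exact le_rfl
        · exact (h4 z hz).trans hlt.le
      · intro z hz
        simp only [SimpleGraph.Walk.support_cons, List.mem_cons, Sum.inr.injEq, reduceCtorEq,
          false_or] at hz
        rcases hz with rfl | hz
        · exact Or.inr ⟨v, hvx, hlt⟩
        · rcases h5 z hz with h | ⟨y, hy, hyr⟩
          · exact Or.inl h
          · exact Or.inr ⟨y, hy, hyr.trans hlt⟩

theorem mem_coverSet_iff {w : W} (hw : w ∉ matchedMachines M) (hM : IsUPerfectMatching I.E M)
    {u : U} : u ∈ I.coverSet M w ↔ u ∈ I.criticalJobs M ∧ AltReach I.E M w u := by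
  classical
  obtain ⟨g, hg, hgE, hgM⟩ := hM.exists_fun
  rw [coverSet, Finset.mem_filter]
  refine and_congr_right fun _ => ⟨?_, exists_walk_of_altReach hw hg hgE hgM⟩
  rintro ⟨p, -, hp⟩
  exact ((altReach_of_walk hw p rfl hp).1 u rfl).1

/-! ## The approximation guarantee -/

theorem NodeRobust.exists_avoiding {Y : Finset W} (hY : I.NodeRobust Y) {f : W} (hf : f ∈ I.F) :
    ∃ g : U → W, Function.Injective g ∧ (∀ u, (u, g u) ∈ I.E) ∧ (∀ u, g u ∈ Y) ∧ ∀ u, g u ≠ f := by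
  obtain ⟨N, hN⟩ := hY f hf
  obtain ⟨g, hg, hgE, -⟩ := hN.exists_fun
  refine ⟨g, hg, fun u => (mem_edgesOn.1 (hgE u)).1, fun u => ?_, fun u => ?_⟩
  · exact Finset.mem_of_mem_erase (mem_edgesOn.1 (hgE u)).2
  · exact Finset.ne_of_mem_erase (mem_edgesOn.1 (hgE u)).2

theorem edgeCost_image (g : U → W) :
    I.edgeCost (Finset.univ.image fun u => (u, g u)) = ∑ u, I.c (g u) := by
  rw [edgeCost, Finset.sum_image]
  exact fun a _ b _ h => congrArg Prod.fst h

theorem eq_image_of_forall_mem_iff {g : U → W} (hM : ∀ u x, (u, x) ∈ M ↔ x = g u) :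
    M = Finset.univ.image fun u => (u, g u) := by
  ext ⟨u, x⟩
  simp [hM, eq_comm]

theorem mem_matchedMachines_iff {g : U → W} (hM : ∀ u x, (u, x) ∈ M ↔ x = g u) {x : W} :
    x ∈ matchedMachines M ↔ ∃ u, g u = x := by
  simp [matchedMachines, hM, eq_comm]

/-- A matching inside `Y` that avoids the machine of `u` must use a machine outside `W^M` from which
`u` is reached. Thus `Y \ W^M` is a cover, which serves as comparison for the greedy algorithm and
also makes the set cover instance solvable. -/
theorem exists_cover {Y : Finset W} (hY : I.NodeRobust Y) (hM : IsUPerfectMatching I.E M) {u : U}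
    (hu : u ∈ I.criticalJobs M) :
    ∃ w ∈ Y \ matchedMachines M, u ∈ I.coverSet M w := by
  obtain ⟨g, hg, hgE, hgM⟩ := hM.exists_fun
  have hu' := hu
  simp only [criticalJobs, Finset.mem_filter, Finset.mem_univ, true_and] at hu'
  obtain ⟨f, hf, huf⟩ := hu'
  rw [hgM] at huf
  subst huf
  obtain ⟨n, hn, hnE, hnY, hnf⟩ := hY.exists_avoiding hf
  obtain ⟨v, hv, hr⟩ := exists_altReach_of_avoids hgM hn hnE hnf
  have hfree : n v ∉ matchedMachines M := by
    rw [mem_matchedMachines_iff hgM]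
    rintro ⟨z, hz⟩
    exact hv z hz
  exact ⟨n v, Finset.mem_sdiff.2 ⟨hnY v, hfree⟩, (mem_coverSet_iff hfree hM).2 ⟨hu, hr⟩⟩

theorem exists_isMinCostMatching (hF : I.F.Nonempty) (hI : I.Feasible) :
    ∃ M, I.IsMinCostMatching M := by
  classical
  obtain ⟨Y, hY⟩ := hI
  -- Without a vulnerable machine node-robustness would be vacuous and would give no perfect
  -- matching.
  obtain ⟨f, hf⟩ := hF
  obtain ⟨n, hn, hnE, -⟩ := hY.exists_avoiding hf
  obtain ⟨M, hM, hmin⟩ := Finset.exists_min_image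
    (Finset.univ.filter fun M => IsUPerfectMatching I.E M) I.edgeCost
    ⟨_, Finset.mem_filter.2 ⟨Finset.mem_univ _, isUPerfectMatching_image hn hnE⟩⟩
  exact ⟨M, (Finset.mem_filter.1 hM).2,
    fun M' hM' => hmin M' (Finset.mem_filter.2 ⟨Finset.mem_univ _, hM'⟩)⟩

theorem exists_algorithmOutput (hF : I.F.Nonempty) (hI : I.Feasible) :
    ∃ X, I.AlgorithmOutput X := by
  obtain ⟨M, hM⟩ := exists_isMinCostMatching hF hI
  obtain ⟨Y, hY⟩ := hI
  obtain ⟨D, hD⟩ := exists_greedyRun (I.coverSet M) I.c (Finset.univ \ matchedMachines M)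
    (I.criticalJobs M) (fun u hu => by
      obtain ⟨w, hw, hw'⟩ := exists_cover hY hM.1 hu
      exact ⟨w, Finset.mem_sdiff.2 ⟨Finset.mem_univ _, (Finset.mem_sdiff.1 hw).2⟩, hw'⟩)
  exact ⟨_, M, D, hM, hD, rfl⟩

theorem AlgorithmOutput.nodeRobust {X : Finset W} (hX : I.AlgorithmOutput X) :
    I.NodeRobust X := by
  obtain ⟨M, D, hM, hD, rfl⟩ := hX
  obtain ⟨g, hg, hgE, hgM⟩ := hM.1.exists_fun
  intro f hf
  -- If `M` does not use `f`, then `M` itself survives. Otherwise `f` serves a critical job, and the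
  -- exchange from a machine of `D` that covers this job avoids `f`.
  by_cases hfg : ∃ u, g u = f
  · obtain ⟨u, rfl⟩ := hfg
    have hu : u ∈ I.criticalJobs M := by
      simp only [criticalJobs, Finset.mem_filter, Finset.mem_univ, true_and]
      exact ⟨_, hf, (hgM _ _).2 rfl⟩
    obtain ⟨w, hwD, hwJ, huw⟩ := hD.exists_mem hu
    have hfree := (Finset.mem_sdiff.1 hwJ).2
    have hr := ((mem_coverSet_iff hfree hM.1).1 huw).2
    rw [mem_matchedMachines_iff hgM, not_exists] at hfree
    obtain ⟨n, hn, hnE, hn', hnu⟩ := hr.exists_exchange hg hgE hgM hfree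
    refine ⟨_, isUPerfectMatching_image hn fun v => mem_edgesOn.2 ⟨hnE v, ?_⟩⟩
    rw [Finset.mem_erase, Finset.mem_union, mem_matchedMachines_iff hgM]
    refine ⟨hnu v, ?_⟩
    rcases hn' v with h | ⟨z, h⟩
    · exact Or.inr (h ▸ hwD)
    · exact Or.inl ⟨z, h.symm⟩
  · rw [not_exists] at hfg
    refine ⟨_, isUPerfectMatching_image hg fun v => mem_edgesOn.2 ⟨hgE v, ?_⟩⟩
    rw [Finset.mem_erase, Finset.mem_union, mem_matchedMachines_iff hgM]
    exact ⟨hfg v, Or.inl ⟨v, rfl⟩⟩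

theorem AlgorithmOutput.cost_le (hF : I.F.Nonempty) {X : Finset W} (hX : I.AlgorithmOutput X)
    {Y : Finset W} (hY : I.NodeRobust Y) :
    I.cost X ≤ (Real.log (Fintype.card U) + 2) * I.cost Y := by
  obtain ⟨M, D, hM, hD, rfl⟩ := hX
  obtain ⟨f, hf⟩ := hF
  obtain ⟨n, hn, hnE, hnY, -⟩ := hY.exists_avoiding hf
  obtain ⟨g, hg, hgE, hgM⟩ := hM.1.exists_fun
  have hWM : I.cost (matchedMachines M) ≤ I.cost Y := by
    have h1 : I.cost (matchedMachines M) = I.edgeCost M := by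
      conv_rhs => rw [eq_image_of_forall_mem_iff hgM, edgeCost_image]
      have : matchedMachines M = Finset.univ.image g := by
        ext x
        simp [mem_matchedMachines_iff hgM]
      rw [this, cost, Finset.sum_image fun a _ b _ h => hg h]
    have h2 := hM.2 _ (isUPerfectMatching_image hn hnE)
    rw [edgeCost_image] at h2
    rw [h1]
    refine h2.trans ?_
    rw [← Finset.sum_image (f := I.c) (g := n) fun a _ b _ h => hn h]
    refine Finset.sum_le_sum_of_subset_of_nonneg ?_ fun x _ _ => I.c_nonneg x
    intro x hx
    obtain ⟨u, -, rfl⟩ := Finset.mem_image.1 hx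
    exact hnY u
  have hDc := hD.sum_le (T := Y \ matchedMachines M) I.c_nonneg
    (Finset.sdiff_subset_sdiff (Finset.subset_univ _) subset_rfl)
    (fun u hu => exists_cover hY hM.1 hu)
  have hYn : 0 ≤ I.cost Y := Finset.sum_nonneg fun x _ => I.c_nonneg x
  have hT : ∑ w ∈ Y \ matchedMachines M, I.c w ≤ I.cost Y :=
    Finset.sum_le_sum_of_subset_of_nonneg Finset.sdiff_subset fun x _ _ => I.c_nonneg x
  have hT0 : 0 ≤ ∑ w ∈ Y \ matchedMachines M, I.c w := Finset.sum_nonneg fun x _ => I.c_nonneg x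
  have hlog : (harmonic (I.criticalJobs M).card : ℝ) ≤ 1 + Real.log (Fintype.card U) := by
    refine (harmonic_le_one_add_log _).trans ?_
    have hc : (I.criticalJobs M).card ≤ Fintype.card U := Finset.card_le_univ _
    rcases Nat.eq_zero_or_pos (I.criticalJobs M).card with h0 | h0
    -- Without critical jobs the logarithm is taken at `0`, where its default value is `0`.
    · rw [h0]
      have := Real.log_natCast_nonneg (Fintype.card U)
      simpa using this
    · gcongr
  have hlog0 := Real.log_natCast_nonneg (Fintype.card U)
  have hunion : I.cost (matchedMachines M ∪ D) ≤ I.cost (matchedMachines M) + ∑ w ∈ D, I.c w := by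
    have := Finset.sum_union_inter (s₁ := matchedMachines M) (s₂ := D) (f := I.c)
    have h0 : 0 ≤ ∑ w ∈ matchedMachines M ∩ D, I.c w := Finset.sum_nonneg fun x _ => I.c_nonneg x
    simp only [cost]
    linarith
  have h3 : (harmonic (I.criticalJobs M).card : ℝ) * ∑ w ∈ Y \ matchedMachines M, I.c w ≤
      (1 + Real.log (Fintype.card U)) * I.cost Y :=
    mul_le_mul hlog hT hT0 (by linarith)
  linarith

end VRAP

end AlternatingPath

/-! ## A local optimality criterion for minimum-cost matchings -/

section Optimality

variable {U W : Type*} [Fintype U]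

/-- A non-negative sum is the integral over `t > 0` of the number of terms exceeding `t` (the
layer-cake formula), so comparing the counts at each threshold compares the sums. -/
theorem sum_le_sum_of_card_superlevel_le {f h : U → ℝ} (hf : ∀ u, 0 ≤ f u) (hh : ∀ u, 0 ≤ h u)
    (H : ∀ θ : ℝ, {u | θ < f u}.encard ≤ {u | θ < h u}.encard) : ∑ u, f u ≤ ∑ u, h u := by
  let _ : MeasurableSpace U := ⊤
  have : DiscreteMeasurableSpace U := ⟨fun _ => trivial⟩
  have key : ∀ f : U → ℝ, (∀ u, 0 ≤ f u) → ENNReal.ofReal (∑ u, f u) =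
      ∫⁻ t in Set.Ioi (0 : ℝ), MeasureTheory.Measure.count {u | t < f u} := by
    intro f hf
    rw [← MeasureTheory.lintegral_eq_lintegral_meas_lt _ (Filter.Eventually.of_forall hf)
      (measurable_of_finite f).aemeasurable, MeasureTheory.lintegral_count, tsum_fintype,
      ENNReal.ofReal_sum_of_nonneg fun u _ => hf u]
  have h1 : ENNReal.ofReal (∑ u, f u) ≤ ENNReal.ofReal (∑ u, h u) := by
    rw [key f hf, key h hh]
    refine MeasureTheory.lintegral_mono fun t => ?_
    rw [MeasureTheory.Measure.count_apply (Set.toFinite _).measurableSet,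
      MeasureTheory.Measure.count_apply (Set.toFinite _).measurableSet]
    exact ENat.toENNReal_le.2 (H t)
  rwa [ENNReal.ofReal_le_ofReal_iff (Finset.sum_nonneg fun u _ => hh u)] at h1

/-- `M` is a matching such that no machine that it leaves uncovered can replace a more expensive
machine or serve an unmatched job along an alternating walk. -/
structure IsLocallyOptimal (E M : Finset (U × W)) (c : W → ℝ) : Prop where
  subset : M ⊆ E
  job_unique : ∀ u v x, (u, x) ∈ M → (v, x) ∈ M → u = v
  machine_unique : ∀ u x y, (u, x) ∈ M → (u, y) ∈ M → x = y
  certificate : ∀ w, (∀ u, (u, w) ∉ M) → ∃ Z : Set W, w ∈ Z ∧ (∀ a ∈ Z, c a ≤ c w) ∧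
    ∀ u, ∀ a ∈ Z, (u, a) ∈ E → ∃ b ∈ Z, (u, b) ∈ M

namespace IsLocallyOptimal

variable {E M : Finset (U × W)} {c : W → ℝ}

/-- An unmatched job counts as served at infinite cost: it lies in the left-hand set for every `θ`.
It is the complements that are compared. Let `Y` be the union of the certificates of the free
machines of cost at most `θ`, and let `n` serve `u` within cost `θ`. If `n u ∈ Y`, then `M` also
serves `u` within `Y`, and `u` is sent to itself. Otherwise `n u` is not free, and `u` is sent to
the job that `M` assigns to `n u`. -/
theorem card_superlevel_le (h : IsLocallyOptimal E M c) {n : U → W} (hn : Function.Injective n)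
    (hnE : ∀ u, (u, n u) ∈ E) (θ : ℝ) :
    {u | ∀ x, (u, x) ∈ M → θ < c x}.encard ≤ {u | θ < c (n u)}.encard := by
  classical
  choose! Z hZ using h.certificate
  let Y : Set W := {a | ∃ w, (∀ u, (u, w) ∉ M) ∧ c w ≤ θ ∧ a ∈ Z w}
  have hYc : ∀ a ∈ Y, c a ≤ θ := by
    rintro a ⟨w, hw, hwθ, ha⟩
    exact ((hZ w hw).2.1 a ha).trans hwθ
  have hYM : ∀ u, ∀ a ∈ Y, (u, a) ∈ E → ∃ b ∈ Y, (u, b) ∈ M := by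
    rintro u a ⟨w, hw, hwθ, ha⟩ hE
    obtain ⟨b, hb, hbM⟩ := (hZ w hw).2.2 u a ha hE
    exact ⟨b, ⟨w, hw, hwθ, hb⟩, hbM⟩
  have hex : ∀ u, c (n u) ≤ θ → ∃ v, (∃ x, (v, x) ∈ M ∧ c x ≤ θ) ∧
      ((n u ∈ Y ∧ v = u) ∨ ((v, n u) ∈ M ∧ ∀ a ∈ Y, (v, a) ∉ E)) := by
    intro u hu
    by_cases hY : n u ∈ Y
    · obtain ⟨b, hb, hbM⟩ := hYM u _ hY (hnE u)
      exact ⟨u, ⟨b, hbM, hYc b hb⟩, Or.inl ⟨hY, rfl⟩⟩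
    · by_cases hm : ∃ v, (v, n u) ∈ M
      · obtain ⟨v, hv⟩ := hm
        refine ⟨v, ⟨_, hv, hu⟩, Or.inr ⟨hv, fun a ha haE => hY ?_⟩⟩
        obtain ⟨b, hb, hbM⟩ := hYM v a ha haE
        rwa [← h.machine_unique _ _ _ hbM hv]
      · push Not at hm
        exact absurd ⟨n u, hm, hu, (hZ _ hm).1⟩ hY
  choose! φ hφ using hex
  have hcompl : {u | θ < c (n u)}ᶜ.encard ≤ {u | ∀ x, (u, x) ∈ M → θ < c x}ᶜ.encard := by
    refine Set.encard_le_encard_of_injOn (f := φ) ?_ ?_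
    · intro u hu
      simp only [Set.mem_compl_iff, Set.mem_ofPred_eq, not_lt] at hu
      obtain ⟨x, hx, hxc⟩ := (hφ u hu).1
      simp only [Set.mem_compl_iff, Set.mem_ofPred_eq, not_forall, not_lt]
      exact ⟨x, hx, hxc⟩
    · intro u hu v hv huv
      simp only [Set.mem_compl_iff, Set.mem_ofPred_eq, not_lt] at hu hv
      -- The two kinds of images cannot meet: one of the first kind has a neighbour in `Y`, one of
      -- the second kind has none.
      rcases (hφ u hu).2 with ⟨h1, h2⟩ | ⟨h1, h2⟩ <;> rcases (hφ v hv).2 with ⟨h3, h4⟩ | ⟨h3, h4⟩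
      · rw [← h2, ← h4, huv]
      · refine absurd (hnE u) ?_
        rw [← huv, h2] at h4
        exact h4 _ h1
      · refine absurd (hnE v) ?_
        rw [huv, h4] at h2
        exact h2 _ h3
      · rw [huv] at h1
        exact hn (h.machine_unique _ _ _ h1 h3)
  have e1 := Set.encard_add_encard_compl {u | θ < c (n u)}
  have e2 := Set.encard_add_encard_compl {u | ∀ x, (u, x) ∈ M → θ < c x}
  rw [← e2] at e1
  have hfin : {u | ∀ x, (u, x) ∈ M → θ < c x}ᶜ.encard ≠ ⊤ := Set.encard_ne_top_iff.2 (Set.toFinite _)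
  have hle : {u | ∀ x, (u, x) ∈ M → θ < c x}.encard + {u | ∀ x, (u, x) ∈ M → θ < c x}ᶜ.encard ≤
      {u | θ < c (n u)}.encard + {u | ∀ x, (u, x) ∈ M → θ < c x}ᶜ.encard := by
    rw [← e1]
    gcongr
  exact (ENat.add_le_add_iff_right hfin).1 hle

theorem isUPerfectMatching [Finite W] (h : IsLocallyOptimal E M c) {n : U → W}
    (hn : Function.Injective n) (hnE : ∀ u, (u, n u) ∈ E) : IsUPerfectMatching E M := by
  refine ⟨h.subset, ?_, fun u => ?_⟩
  · rintro ⟨u, x⟩ he ⟨v, y⟩ he' hne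
    refine ⟨fun huv => hne ?_, fun hxy => hne ?_⟩
    · change u = v at huv
      subst huv
      rw [h.machine_unique _ _ _ he he']
    · change x = y at hxy
      subst hxy
      rw [h.job_unique _ _ _ he he']
  -- At a threshold above all costs the count for `n` is zero, so no job is left unmatched by `M`.
  · obtain ⟨θ, hθ⟩ := (Set.finite_range c).bddAbove
    have hθ' : ∀ x, c x ≤ θ := fun x => hθ ⟨x, rfl⟩
    have := h.card_superlevel_le hn hnE θ
    have hempty : {u | θ < c (n u)} = ∅ := by
      ext u
      simp [hθ']
    rw [hempty, Set.encard_empty, nonpos_iff_eq_zero, Set.encard_eq_zero] at this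
    have hu : u ∉ {u | ∀ x, (u, x) ∈ M → θ < c x} := by
      rw [this]
      exact Set.notMem_empty u
    simp only [Set.mem_ofPred_eq, not_forall] at hu
    obtain ⟨x, hx, -⟩ := hu
    exact ⟨_, hx, rfl⟩

theorem isMinCostMatching [Fintype W] [DecidableEq U] [DecidableEq W] {I : VRAP U W}
    {M : Finset (U × W)} (h : IsLocallyOptimal I.E M I.c) {n : U → W}
    (hn : Function.Injective n) (hnE : ∀ u, (u, n u) ∈ I.E) : I.IsMinCostMatching M := by
  have hM := h.isUPerfectMatching hn hnE
  refine ⟨hM, fun M' hM' => ?_⟩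
  obtain ⟨g, -, -, hgM⟩ := hM.exists_fun
  obtain ⟨g', hg', hgE', hgM'⟩ := hM'.exists_fun
  rw [VRAP.eq_image_of_forall_mem_iff hgM, VRAP.eq_image_of_forall_mem_iff hgM',
    VRAP.edgeCost_image, VRAP.edgeCost_image]
  refine sum_le_sum_of_card_superlevel_le (fun _ => I.c_nonneg _) (fun _ => I.c_nonneg _)
    fun θ => ?_
  have := h.card_superlevel_le hg' hgE' θ
  simpa [hgM] using this

end IsLocallyOptimal

end Optimality

/-! ## Programs with bounded loops -/

namespace RAM

/-- Programs whose only loops run a variable `v` from `0` up to the value in entry `(0, 0)` of an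
array `a`. -/
inductive Prog
  | skip
  | setNat (a : ℕ) (i j x : NExp)
  | setReal (a : ℕ) (i : NExp) (x : RExp)
  | seq (p q : Prog)
  | cond (b : Test) (p q : Prog)
  | forTo (v a : ℕ) (p : Prog)

/-- The entry `(0, 0)` of an integer array, used as a scalar variable. -/
abbrev NExp.var (a : ℕ) : NExp := .get a (.const 0) (.const 0)

/-- The entry `(i, 0)` of an integer array. -/
abbrev NExp.col (a : ℕ) (i : NExp) : NExp := .get a i (.const 0)

namespace Prog

/-- Assignment to a scalar variable. -/
abbrev setVar (a : ℕ) (x : NExp) : Prog := .setNat a (.const 0) (.const 0) x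

/-- Assignment to an entry in column `0`. -/
abbrev setCol (a : ℕ) (i x : NExp) : Prog := .setNat a i (.const 0) x

/-- A conditional without alternative. -/
abbrev when (b : Test) (p : Prog) : Prog := .cond b p .skip

/-- The translation to general programs. -/
def toCmd : Prog → Cmd
  | skip => .skip
  | setNat a i j x => .setNat a i j x
  | setReal a i x => .setReal a i x
  | seq p q => .seq p.toCmd q.toCmd
  | cond b p q => .cond b p.toCmd q.toCmd
  | forTo v a p => .seq (.setNat v (.const 0) (.const 0) (.const 0))
      (.loop (.natLt (.var v) (.var a))
        (.seq p.toCmd (.setNat v (.const 0) (.const 0) (.add (.var v) (.const 1)))))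

open Classical in
/-- The memory after the execution of a program. -/
noncomputable def den : Prog → State → State
  | skip, s => s
  | setNat a i j x, s => s.writeNat a (i.eval s) (j.eval s) (x.eval s)
  | setReal a i x, s => s.writeReal a (i.eval s) (x.eval s)
  | seq p q, s => q.den (p.den s)
  | cond b p q, s => if b.Holds s then p.den s else q.den s
  | forTo v a p, s =>
      (fun s' => (p.den s').writeNat v 0 0 ((p.den s').nat v 0 0 + 1))^[s.nat a 0 0]
        (s.writeNat v 0 0 0)

/-- The integer arrays that a program writes. -/
def natWrites : Prog → List ℕ
  | skip => []
  | setNat a _ _ _ => [a]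
  | setReal _ _ _ => []
  | seq p q => p.natWrites ++ q.natWrites
  | cond _ p q => p.natWrites ++ q.natWrites
  | forTo v _ p => v :: p.natWrites

/-- The real arrays that a program writes. -/
def realWrites : Prog → List ℕ
  | skip => []
  | setNat _ _ _ _ => []
  | setReal a _ _ => [a]
  | seq p q => p.realWrites ++ q.realWrites
  | cond _ p q => p.realWrites ++ q.realWrites
  | forTo _ _ p => p.realWrites

/-- Loop bodies do not write the loop variable, and loop bounds are entries of the arrays `0` and
`1`, which are not written. -/
def WellFormed : Prog → Bool
  | skip => true
  | setNat a _ _ _ => 1 < a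
  | setReal _ _ _ => true
  | seq p q => p.WellFormed && q.WellFormed
  | cond _ p q => p.WellFormed && q.WellFormed
  | forTo v a p => 1 < v && a < 2 && !(p.natWrites.contains v) && p.WellFormed

/-- An upper bound for the number of steps in terms of an upper bound for the entries `(0, 0)` of
the arrays `0` and `1`. -/
noncomputable def timeBound : Prog → Polynomial ℕ
  | skip => 1
  | setNat _ _ _ _ => 1
  | setReal _ _ _ => 1
  | seq p q => p.timeBound + q.timeBound
  | cond _ p q => 1 + (p.timeBound + q.timeBound)
  | forTo _ _ p => 1 + (1 + Polynomial.X * (p.timeBound + 2))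

/-- The memories `s` and `s'` agree except on the arrays that `p` writes. -/
structure Frame (p : Prog) (s s' : State) : Prop where
  nat : ∀ b, b ∉ p.natWrites → s'.nat b = s.nat b
  real : ∀ b, b ∉ p.realWrites → s'.real b = s.real b

end Prog

@[simp]
theorem State.writeNat_nat (s : State) (a i j v a' i' j' : ℕ) :
    (s.writeNat a i j v).nat a' i' j' = if a' = a ∧ i' = i ∧ j' = j then v else s.nat a' i' j' :=
  rfl

theorem State.writeNat_nat_of_ne (s : State) {a i j v b : ℕ} (h : b ≠ a) :
    (s.writeNat a i j v).nat b = s.nat b := by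
  funext i' j'
  simp [h]

@[simp]
theorem State.writeReal_nat (s : State) (a i : ℕ) (v : ℝ) : (s.writeReal a i v).nat = s.nat :=
  rfl

@[simp]
theorem State.writeReal_real (s : State) (a i : ℕ) (v : ℝ) (a' i' : ℕ) :
    (s.writeReal a i v).real a' i' = if a' = a ∧ i' = i then v else s.real a' i' :=
  rfl

theorem State.writeReal_real_of_ne (s : State) {a i b : ℕ} {v : ℝ} (h : b ≠ a) :
    (s.writeReal a i v).real b = s.real b := by
  funext i'
  simp [h]

namespace Prog

theorem den_seq (p q : Prog) (s : State) : (seq p q).den s = q.den (p.den s) :=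
  rfl

theorem den_cond_of {b : Test} {s : State} (h : b.Holds s) (p q : Prog) :
    (cond b p q).den s = p.den s :=
  if_pos h

theorem den_cond_of_not {b : Test} {s : State} (h : ¬ b.Holds s) (p q : Prog) :
    (cond b p q).den s = q.den s :=
  if_neg h

theorem den_when_of_not {b : Test} {s : State} (h : ¬ b.Holds s) (p : Prog) :
    (when b p).den s = s :=
  if_neg h

theorem frame (p : Prog) (s : State) : p.Frame s (p.den s) := by
  induction p generalizing s with
  | skip => exact ⟨fun _ _ => rfl, fun _ _ => rfl⟩
  | setNat a i j x =>
    exact ⟨fun b hb => State.writeNat_nat_of_ne _ (by simpa [natWrites] using hb), fun _ _ => rfl⟩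
  | setReal a i x =>
    exact ⟨fun _ _ => rfl, fun b hb => State.writeReal_real_of_ne _ (by simpa [realWrites] using hb)⟩
  | seq p q hp hq =>
    refine ⟨fun b hb => ?_, fun b hb => ?_⟩
    · simp only [natWrites, List.mem_append, not_or] at hb
      exact ((hq _).nat b hb.2).trans ((hp _).nat b hb.1)
    · simp only [realWrites, List.mem_append, not_or] at hb
      exact ((hq _).real b hb.2).trans ((hp _).real b hb.1)
  | cond b p q hp hq =>
    refine ⟨fun b hb => ?_, fun b hb => ?_⟩
    · simp only [natWrites, List.mem_append, not_or] at hb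
      rw [den]
      split_ifs
      · exact (hp _).nat b hb.1
      · exact (hq _).nat b hb.2
    · simp only [realWrites, List.mem_append, not_or] at hb
      rw [den]
      split_ifs
      · exact (hp _).real b hb.1
      · exact (hq _).real b hb.2
  | forTo v a p hp =>
    rw [den]
    generalize s.nat a 0 0 = k
    induction k with
    | zero =>
      refine ⟨fun b hb => ?_, fun _ _ => rfl⟩
      simp only [natWrites, List.mem_cons, not_or] at hb
      exact State.writeNat_nat_of_ne _ hb.1
    | succ k ih =>
      rw [Function.iterate_succ_apply']
      refine ⟨fun b hb => ?_, fun b hb => ?_⟩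
      · rw [← ih.nat b hb]
        simp only [natWrites, List.mem_cons, not_or] at hb
        rw [State.writeNat_nat_of_ne _ hb.1]
        exact (hp _).nat b hb.2
      · rw [← ih.real b hb]
        exact (hp _).real b hb

/-- The rule for loops: the assertion `Inv k` holds whenever the loop variable has the value `k`. -/
theorem den_forTo {v a : ℕ} {p : Prog} {s : State} (hv : v ∉ p.natWrites)
    (Inv : ℕ → State → Prop) (hcongr : ∀ k s j, Inv k s → Inv k (s.writeNat v 0 0 j))
    (h0 : Inv 0 s)
    (hstep : ∀ k < s.nat a 0 0, ∀ s', (forTo v a p).Frame s s' → s'.nat v 0 0 = k → Inv k s' →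
      Inv (k + 1) (p.den s')) :
    Inv (s.nat a 0 0) ((forTo v a p).den s) := by
  -- The frame condition and the value of the counter are carried along with the invariant. `hcongr`
  -- accounts for the write to the counter between two executions of the body.
  suffices H : ∀ k ≤ s.nat a 0 0, ∀ s', s' = (fun s' => (p.den s').writeNat v 0 0
      ((p.den s').nat v 0 0 + 1))^[k] (s.writeNat v 0 0 0) →
      Inv k s' ∧ (forTo v a p).Frame s s' ∧ s'.nat v 0 0 = k from (H _ le_rfl _ rfl).1
  intro k
  induction k with
  | zero =>
    rintro - s' rfl
    refine ⟨hcongr _ _ _ h0, ⟨fun b hb => ?_, fun _ _ => rfl⟩, by simp⟩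
    simp only [natWrites, List.mem_cons, not_or] at hb
    exact State.writeNat_nat_of_ne _ hb.1
  | succ k ih =>
    rintro hk s' rfl
    rw [Function.iterate_succ_apply']
    obtain ⟨h1, h2, h3⟩ := ih (by omega) _ rfl
    generalize (fun s' => (p.den s').writeNat v 0 0 ((p.den s').nat v 0 0 + 1))^[k]
      (s.writeNat v 0 0 0) = s' at h1 h2 h3
    have hp := p.frame s'
    refine ⟨hcongr _ _ _ (hstep k (by omega) _ h2 h3 h1), ⟨fun b hb => ?_, fun b hb => ?_⟩, ?_⟩
    · rw [← h2.nat b hb]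
      simp only [natWrites, List.mem_cons, not_or] at hb
      rw [State.writeNat_nat_of_ne _ hb.1]
      exact hp.nat b hb.2
    · rw [← h2.real b hb]
      exact hp.real b hb
    · simp [hp.nat v hv, h3]

theorem WellFormed.not_mem {p : Prog} (h : p.WellFormed) {b : ℕ} (hb : b < 2) :
    b ∉ p.natWrites := by
  induction p with
  | skip => simp [natWrites]
  | setNat a i j x =>
    simp only [WellFormed, decide_eq_true_eq] at h
    simp only [natWrites, List.mem_singleton]
    omega
  | setReal a i x => simp [natWrites]
  | seq p q hp hq =>
    simp only [WellFormed, Bool.and_eq_true] at h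
    simp [natWrites, hp h.1, hq h.2]
  | cond b p q hp hq =>
    simp only [WellFormed, Bool.and_eq_true] at h
    simp [natWrites, hp h.1, hq h.2]
  | forTo v a p hp =>
    simp only [WellFormed, Bool.and_eq_true, decide_eq_true_eq] at h
    simp only [natWrites, List.mem_cons, not_or]
    exact ⟨by omega, hp h.2⟩

/-- Since neither the bound nor the counter is written by the body, a loop makes exactly as many
rounds as the bound says on entry. Each round adds two steps to the body, the test and the
increment; the initialization and the final test give one step each. -/
theorem exec {p : Prog} (h : p.WellFormed) {N : ℕ} {s : State} (h0 : s.nat 0 0 0 ≤ N)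
    (h1 : s.nat 1 0 0 ≤ N) : ∃ t ≤ p.timeBound.eval N, Exec p.toCmd s t (p.den s) := by
  induction p generalizing s with
  | skip => exact ⟨1, by simp [timeBound], .skip s⟩
  | setNat a i j x => exact ⟨1, by simp [timeBound], .setNat s a i j x⟩
  | setReal a i x => exact ⟨1, by simp [timeBound], .setReal s a i x⟩
  | seq p q hp hq =>
    simp only [WellFormed, Bool.and_eq_true] at h
    obtain ⟨t, ht, he⟩ := hp h.1 h0 h1
    have hf := p.frame s
    obtain ⟨t', ht', he'⟩ := hq h.2 (s := p.den s)
      (by rwa [hf.nat 0 (WellFormed.not_mem h.1 (by norm_num))])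
      (by rwa [hf.nat 1 (WellFormed.not_mem h.1 (by norm_num))])
    refine ⟨t + t', ?_, .seq _ _ _ _ _ _ _ he he'⟩
    simp only [timeBound, Polynomial.eval_add]
    omega
  | cond b p q hp hq =>
    simp only [WellFormed, Bool.and_eq_true] at h
    rw [den]
    split_ifs with hb
    · obtain ⟨t, ht, he⟩ := hp h.1 h0 h1
      refine ⟨1 + t, ?_, .condTrue _ _ _ _ _ _ hb he⟩
      simp only [timeBound, Polynomial.eval_add, Polynomial.eval_one]
      omega
    · obtain ⟨t, ht, he⟩ := hq h.2 h0 h1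
      refine ⟨1 + t, ?_, .condFalse _ _ _ _ _ _ hb he⟩
      simp only [timeBound, Polynomial.eval_add, Polynomial.eval_one]
      omega
  | forTo v a p hp =>
    simp only [WellFormed, Bool.and_eq_true, decide_eq_true_eq, Bool.not_eq_true',
      List.contains_eq_mem, decide_eq_false_iff_not] at h
    obtain ⟨⟨⟨hv, ha⟩, hvp⟩, hpw⟩ := h
    have hloop : ∀ k, ∀ s : State, s.nat 0 0 0 ≤ N → s.nat 1 0 0 ≤ N →
        s.nat v 0 0 + k = s.nat a 0 0 →
        ∃ t ≤ 1 + k * (p.timeBound.eval N + 2),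
          Exec (.loop (.natLt (.var v) (.var a)) (.seq p.toCmd
            (.setNat v (.const 0) (.const 0) (.add (.var v) (.const 1))))) s t
            ((fun s' => (p.den s').writeNat v 0 0 ((p.den s').nat v 0 0 + 1))^[k] s) := by
      intro k
      induction k with
      | zero =>
        intro s _ _ hs
        refine ⟨1, by omega, .loopFalse _ _ _ ?_⟩
        simp only [Test.Holds, NExp.eval]
        omega
      | succ k ih =>
        intro s hs0 hs1 hs
        obtain ⟨t, ht, he⟩ := hp hpw hs0 hs1
        have hf := p.frame s
        have hf0 := hf.nat 0 (WellFormed.not_mem hpw (by norm_num))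
        have hf1 := hf.nat 1 (WellFormed.not_mem hpw (by norm_num))
        have hfa := hf.nat a (WellFormed.not_mem hpw ha)
        have hfv := hf.nat v hvp
        have hne : a ≠ v := by omega
        obtain ⟨t', ht', he'⟩ := ih ((p.den s).writeNat v 0 0 ((p.den s).nat v 0 0 + 1))
          (by rw [State.writeNat_nat_of_ne _ (by omega), hf0]; exact hs0)
          (by rw [State.writeNat_nat_of_ne _ (by omega), hf1]; exact hs1)
          (by
            rw [State.writeNat_nat_of_ne _ hne, hfa, hfv]
            simp only [State.writeNat_nat, and_self, if_true]
            omega)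
        refine ⟨1 + (t + 1) + t', ?_, ?_⟩
        · rw [add_mul]
          omega
        · rw [Function.iterate_succ_apply]
          refine .loopTrue _ _ _ _ _ _ _ ?_ (.seq _ _ _ _ _ _ _ he (.setNat _ _ _ _ _)) he'
          simp only [Test.Holds, NExp.eval]
          omega
    have hne : a ≠ v := by omega
    obtain ⟨t, ht, he⟩ := hloop (s.nat a 0 0) (s.writeNat v 0 0 0)
      (by rw [State.writeNat_nat_of_ne _ (by omega)]; exact h0)
      (by rw [State.writeNat_nat_of_ne _ (by omega)]; exact h1)
      (by rw [State.writeNat_nat_of_ne _ hne]; simp)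
    refine ⟨1 + t, ?_, .seq _ _ _ _ _ _ _ (.setNat _ _ _ _ _) he⟩
    have haN : s.nat a 0 0 ≤ N := by
      interval_cases a
      · exact h0
      · exact h1
    have := Nat.mul_le_mul_right (p.timeBound.eval N + 2) haN
    simp only [timeBound, Polynomial.eval_add, Polynomial.eval_one, Polynomial.eval_mul,
      Polynomial.eval_X, Polynomial.eval_ofNat]
    omega

end Prog

end RAM

/-! ## Searching alternating walks -/

namespace RAM

/-- Column `0` of an integer array. -/
def State.col (s : State) (a i : ℕ) : ℕ := s.nat a i 0

theorem State.col_writeNat_self (s : State) (a i v : ℕ) :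
    (s.writeNat a i 0 v).col a = Function.update (s.col a) i v := by
  funext i'
  simp [State.col, Function.update_apply]

theorem State.col_writeNat_of_ne (s : State) {a b : ℕ} (i j v : ℕ) (h : b ≠ a) :
    (s.writeNat a i j v).col b = s.col b := by
  funext i'
  simp [State.col, h]

theorem Prog.Frame.col {p : Prog} {s s' : State} (h : p.Frame s s') (b : ℕ)
    (hb : b ∉ p.natWrites) : s'.col b = s.col b := by
  funext i
  simp only [State.col, h.nat b hb]

/-- The adjacency relation in the memory. -/
def State.Adj (s : State) (u x : ℕ) : Prop := s.nat 2 u x = 1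

theorem Prog.Frame.adj {p : Prog} {s s' : State} (h : p.Frame s s') (hp : 2 ∉ p.natWrites) :
    s'.Adj = s.Adj := by
  funext u x
  simp only [State.Adj, h.nat 2 hp]

/-- The jobs that are reached from the machine `w` by alternating walks.  The job `v` is matched to
the machine `x` if `mate v = x + 1`. -/
inductive Reach (A : ℕ → ℕ → Prop) (m : ℕ) (mate : ℕ → ℕ) (w : ℕ) : ℕ → Prop
  | base {u : ℕ} (hu : u < m) (h : A u w) : Reach A m mate w u
  | step {u v x : ℕ} (hv : Reach A m mate w v) (hx : mate v = x + 1) (hu : u < m) (h : A u x) :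
      Reach A m mate w u

theorem Reach.lt {A : ℕ → ℕ → Prop} {m : ℕ} {mate : ℕ → ℕ} {w u : ℕ}
    (h : Reach A m mate w u) : u < m := by
  cases h <;> assumption

/-- A forest of alternating walks from `w`: the jobs that are reached have a level `lvl u ≠ 0`, and
those that are not adjacent to `w` have a parent of smaller level. -/
structure SearchTree (A : ℕ → ℕ → Prop) (m : ℕ) (mate : ℕ → ℕ) (w B : ℕ) (lvl par : ℕ → ℕ) :
    Prop where
  le : ∀ u < m, lvl u ≤ B
  parent : ∀ u < m, lvl u ≠ 0 → (par u = 0 ∧ A u w) ∨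
    ∃ v x, v < m ∧ par u = v + 1 ∧ lvl v ≠ 0 ∧ lvl v < lvl u ∧ mate v = x + 1 ∧ A u x
  root : ∀ u < m, A u w → lvl u ≠ 0

theorem SearchTree.mono {A : ℕ → ℕ → Prop} {m : ℕ} {mate : ℕ → ℕ} {w B B' : ℕ} {lvl par : ℕ → ℕ}
    (h : SearchTree A m mate w B lvl par) (hB : B ≤ B') : SearchTree A m mate w B' lvl par :=
  ⟨fun u hu => (h.le u hu).trans hB, h.parent, h.root⟩

theorem SearchTree.reach {A : ℕ → ℕ → Prop} {m : ℕ} {mate : ℕ → ℕ} {w B : ℕ} {lvl par : ℕ → ℕ}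
    (h : SearchTree A m mate w B lvl par) {u : ℕ} (hu : u < m) (hl : lvl u ≠ 0) :
    Reach A m mate w u := by
  suffices H : ∀ k u, lvl u = k → u < m → lvl u ≠ 0 → Reach A m mate w u from H _ u rfl hu hl
  intro k
  induction k using Nat.strong_induction_on with
  | _ k ih =>
    intro u hk hu hl
    rcases h.parent u hu hl with ⟨-, h0⟩ | ⟨v, x, hv, -, hlv, hlt, hx, hA⟩
    · exact .base hu h0
    · exact .step (ih _ (hk ▸ hlt) v rfl hv hlv) hx hu hA

/-- The new job gets the top level `B` and its parent lies strictly below. Only unmarked jobs are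
changed, so the parents of all others remain valid. -/
theorem SearchTree.update {A : ℕ → ℕ → Prop} {m : ℕ} {mate : ℕ → ℕ} {w B : ℕ} {lvl par : ℕ → ℕ}
    (h : SearchTree A m mate w B lvl par) {u v x : ℕ} (hl : lvl u = 0) (hv : v < m)
    (hlv : lvl v ≠ 0) (hlt : lvl v < B) (hx : mate v = x + 1) (hA : A u x) :
    SearchTree A m mate w B (Function.update lvl u B) (Function.update par u (v + 1)) := by
  have hne : ∀ z, lvl z ≠ 0 → z ≠ u := by
    rintro z hz rfl
    exact hz hl
  refine ⟨fun z hz => ?_, fun z hz hlz => ?_, fun z hz hAz => ?_⟩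
  · by_cases hzu : z = u
    · simp [hzu]
    · simpa [hzu] using h.le z hz
  · by_cases hzu : z = u
    · subst hzu
      right
      refine ⟨v, x, hv, ?_, ?_, ?_, hx, hA⟩ <;> simp [hne v hlv, hlv, hlt]
    · simp only [Function.update_of_ne hzu] at hlz ⊢
      rcases h.parent z hz hlz with h0 | ⟨y, x', hy, h1, h2, h3, h4⟩
      · exact Or.inl h0
      · refine Or.inr ⟨y, x', hy, h1, ?_, ?_, h4⟩ <;> simpa [hne y h2]
  · have := h.root z hz hAz
    simpa [hne z this] using this

namespace Prog

/-- Marks the jobs that are adjacent to the machine in variable `10`. -/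
def searchInit : Prog :=
  .forTo 13 0 (.cond (.natEq (.get 2 (.var 13) (.var 10)) (.const 1))
    (.seq (setCol 6 (.var 13) (.const 1)) (setCol 7 (.var 13) (.const 0)))
    (setCol 6 (.var 13) (.const 0)))

/-- Marks the jobs that are adjacent to the machine of the job in variable `12`. -/
def searchScan : Prog :=
  .forTo 13 0 (when (.conj (.natEq (.col 6 (.var 13)) (.const 0))
      (.natEq (.get 2 (.var 13) (.sub (.col 5 (.var 12)) (.const 1))) (.const 1)))
    (.seq (setCol 6 (.var 13) (.add (.var 11) (.const 2)))
      (setCol 7 (.var 13) (.add (.var 12) (.const 1)))))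

/-- Scans all jobs that were marked in the previous rounds. -/
def searchRound : Prog :=
  .forTo 12 0 (when (.conj (.natLt (.const 0) (.col 6 (.var 12)))
    (.conj (.natLt (.col 6 (.var 12)) (.add (.var 11) (.const 2)))
      (.natLt (.const 0) (.col 5 (.var 12))))) searchScan)

/-- Computes levels and parents of all jobs that are reached from the machine in variable `10`. -/
def search : Prog :=
  .seq searchInit (.forTo 11 0 searchRound)

/-- Encoding: array `5` holds mates and array `7` parents, both shifted by one so that `0` means
none; array `6` holds levels, with `0` for jobs not reached. Variable `10` is the machine at the
root, whose neighbours get level `1`. -/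
theorem den_searchInit (s : State) :
    SearchTree s.Adj (s.nat 0 0 0) (s.col 5) (s.nat 10 0 0) 1 ((searchInit.den s).col 6)
      ((searchInit.den s).col 7) := by
  have H := den_forTo (v := 13) (a := 0) (s := s) (p := (.cond
      (.natEq (.get 2 (.var 13) (.var 10)) (.const 1))
      (.seq (setCol 6 (.var 13) (.const 1)) (setCol 7 (.var 13) (.const 0)))
      (setCol 6 (.var 13) (.const 0)))) (by decide)
    (fun k s' => ∀ u < k, (s'.col 6 u = 1 ∧ s'.col 7 u = 0 ∧ s.Adj u (s.nat 10 0 0)) ∨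
      (s'.col 6 u = 0 ∧ ¬ s.Adj u (s.nat 10 0 0))) ?_ (by simp) ?_
  · refine ⟨fun u hu => ?_, fun u hu hl => ?_, fun u hu hA => ?_⟩ <;>
      rcases H u hu with ⟨h1, h2, h3⟩ | ⟨h1, h2⟩
    · exact h1.le
    · exact h1.le.trans zero_le_one
    · exact Or.inl ⟨h2, h3⟩
    · exact absurd h1 hl
    · exact h1.trans_ne one_ne_zero
    · exact absurd hA h2
  · intro k s' j h
    rwa [State.col_writeNat_of_ne _ _ _ _ (by decide), State.col_writeNat_of_ne _ _ _ _ (by decide)]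
  · intro k hk s' hf hv hI u hu
    have h10 : s'.nat 10 = s.nat 10 := hf.nat 10 (by decide)
    have h2 : s'.nat 2 = s.nat 2 := hf.nat 2 (by decide)
    simp only [den, Test.Holds, NExp.eval, hv, h10, h2]
    have huk : u ≠ k → u < k := by omega
    split_ifs with hA
    · by_cases hue : u = k
      · subst hue
        left
        exact ⟨by simp [State.col], by simp [State.col, hv], hA⟩
      · simpa [State.col, hv, hue] using hI u (huk hue)
    · by_cases hue : u = k
      · subst hue
        right
        exact ⟨by simp [State.col], hA⟩
      · simpa [State.col, hv, hue] using hI u (huk hue)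

/-- `lvl₀` stands for the levels at the start of the round. A job marked during the round gets level
`s.nat 11 0 0 + 2`, which the test in `searchRound` excludes, so it is not scanned before the next
round. -/
theorem den_searchScan {s : State} {w x : ℕ} {lvl₀ : ℕ → ℕ}
    (hv : s.nat 12 0 0 < s.nat 0 0 0) (hlv : s.col 6 (s.nat 12 0 0) ≠ 0)
    (hlt : s.col 6 (s.nat 12 0 0) < s.nat 11 0 0 + 2) (hx : s.col 5 (s.nat 12 0 0) = x + 1)
    (htree : SearchTree s.Adj (s.nat 0 0 0) (s.col 5) w (s.nat 11 0 0 + 2) (s.col 6) (s.col 7))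
    (hext : ∀ u, s.col 6 u = lvl₀ u ∨ (lvl₀ u = 0 ∧ s.col 6 u = s.nat 11 0 0 + 2)) :
    SearchTree s.Adj (s.nat 0 0 0) (s.col 5) w (s.nat 11 0 0 + 2) ((searchScan.den s).col 6)
      ((searchScan.den s).col 7) ∧
    (∀ u, (searchScan.den s).col 6 u = lvl₀ u ∨
      (lvl₀ u = 0 ∧ (searchScan.den s).col 6 u = s.nat 11 0 0 + 2)) ∧
    (∀ u, s.col 6 u ≠ 0 → (searchScan.den s).col 6 u ≠ 0) ∧
    ∀ u < s.nat 0 0 0, s.Adj u x → (searchScan.den s).col 6 u ≠ 0 := by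
  refine (den_forTo (v := 13) (a := 0) (s := s) (by decide)
    (fun k s' => (SearchTree s.Adj (s.nat 0 0 0) (s.col 5) w (s.nat 11 0 0 + 2) (s'.col 6)
      (s'.col 7)) ∧ (∀ u, s'.col 6 u = lvl₀ u ∨ (lvl₀ u = 0 ∧ s'.col 6 u = s.nat 11 0 0 + 2)) ∧
      (∀ u, s.col 6 u ≠ 0 → s'.col 6 u = s.col 6 u) ∧
      ∀ u < k, s.Adj u x → s'.col 6 u ≠ 0) ?_ ⟨htree, hext, fun _ _ => rfl, by simp⟩ ?_).imp_right
    (And.imp_right (And.imp_left fun h u hu => (h u hu).trans_ne hu))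
  · intro k s' j h
    rwa [State.col_writeNat_of_ne _ _ _ _ (by decide), State.col_writeNat_of_ne _ _ _ _ (by decide)]
  · rintro k hk s' hf hv' ⟨hI1, hI2, hI3, hI4⟩
    have h12 : s'.nat 12 = s.nat 12 := hf.nat 12 (by decide)
    have h11 : s'.nat 11 = s.nat 11 := hf.nat 11 (by decide)
    have h5 : s'.nat 5 = s.nat 5 := hf.nat 5 (by decide)
    have h2 : s'.nat 2 = s.nat 2 := hf.nat 2 (by decide)
    have hx' : s.nat 5 (s.nat 12 0 0) 0 = x + 1 := hx
    simp only [den, Test.Holds, NExp.eval, hv', h12, h11, h5, h2, hx', Nat.add_sub_cancel]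
    split_ifs with hA
    · obtain ⟨hl0, hA⟩ := hA
      have e1 : s'.nat 13 0 0 = k := hv'
      simp only [State.writeNat_nat, Nat.reduceEqDiff,
        false_and, if_false, e1, h12]
      rw [State.col_writeNat_of_ne _ _ _ _ (by decide : (6 : ℕ) ≠ 7), State.col_writeNat_self,
        State.col_writeNat_self, State.col_writeNat_of_ne _ _ _ _ (by decide : (7 : ℕ) ≠ 6)]
      have hlv' := hI3 _ hlv
      have hl0' : s'.col 6 k = 0 := hl0
      refine ⟨hI1.update hl0 hv (hlv'.trans_ne hlv) (hlv'.trans_lt hlt) hx hA, fun u => ?_,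
        fun u hu => ?_, fun u hu hAu => ?_⟩
      · by_cases hu : u = k
        · subst hu
          right
          refine ⟨?_, by simp⟩
          rcases hI2 u with h | h
          · rw [← h, hl0']
          · exact h.1
        · simpa [hu] using hI2 u
      · have hne : u ≠ k := by
          rintro rfl
          exact hu ((hI3 u hu).symm.trans hl0')
        simpa [hne] using hI3 u hu
      · by_cases hue : u = k
        · simp [hue]
        · simpa [hue] using hI4 u (by omega) hAu
    · refine ⟨hI1, hI2, hI3, fun u hu hAu h0 => ?_⟩
      by_cases hue : u = k
      · subst hue
        exact hA ⟨h0, hAu⟩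
      · exact hI4 u (by omega) hAu h0

theorem den_searchRound {s : State} {w : ℕ}
    (htree : SearchTree s.Adj (s.nat 0 0 0) (s.col 5) w (s.nat 11 0 0 + 1) (s.col 6) (s.col 7)) :
    SearchTree s.Adj (s.nat 0 0 0) (s.col 5) w (s.nat 11 0 0 + 2) ((searchRound.den s).col 6)
      ((searchRound.den s).col 7) ∧
    (∀ u, s.col 6 u ≠ 0 → (searchRound.den s).col 6 u ≠ 0) ∧
    ∀ v < s.nat 0 0 0, s.col 6 v ≠ 0 → ∀ x, s.col 5 v = x + 1 → ∀ u < s.nat 0 0 0, s.Adj u x →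
      (searchRound.den s).col 6 u ≠ 0 := by
  have H := den_forTo (v := 12) (a := 0) (s := s) (p := when
    (.conj (.natLt (.const 0) (.col 6 (.var 12)))
    (.conj (.natLt (.col 6 (.var 12)) (.add (.var 11) (.const 2)))
      (.natLt (.const 0) (.col 5 (.var 12))))) searchScan) (by decide)
    (fun k s' => (SearchTree s.Adj (s.nat 0 0 0) (s.col 5) w (s.nat 11 0 0 + 2) (s'.col 6)
      (s'.col 7)) ∧ (∀ u, s'.col 6 u = s.col 6 u ∨
        (s.col 6 u = 0 ∧ s'.col 6 u = s.nat 11 0 0 + 2)) ∧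
      ∀ v < k, s.col 6 v ≠ 0 → ∀ x, s.col 5 v = x + 1 → ∀ u < s.nat 0 0 0, s.Adj u x →
        s'.col 6 u ≠ 0) ?_ ⟨htree.mono (by omega), fun _ => Or.inl rfl, by simp⟩ ?_
  · refine ⟨H.1, fun u hu => ?_, H.2.2⟩
    rcases H.2.1 u with h | h
    · exact h.trans_ne hu
    · exact absurd h.1 hu
  · intro k s' j h
    rwa [State.col_writeNat_of_ne _ _ _ _ (by decide), State.col_writeNat_of_ne _ _ _ _ (by decide)]
  · rintro k hk s' hf hv ⟨hI1, hI2, hI3⟩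
    have h0 : s'.nat 0 = s.nat 0 := hf.nat 0 (by decide)
    have h11 : s'.nat 11 = s.nat 11 := hf.nat 11 (by decide)
    have h5 : s'.col 5 = s.col 5 := hf.col 5 (by decide)
    have h2 : s'.Adj = s.Adj := hf.adj (by decide)
    rw [den]
    split_ifs with ht
    · obtain ⟨t1, t2, t3⟩ := ht
      simp only [Test.Holds, NExp.eval] at t1 t2 t3
      obtain ⟨x, hx⟩ := Nat.exists_eq_succ_of_ne_zero t3.ne'
      obtain ⟨j1, j2, j3, j4⟩ := den_searchScan (s := s') (w := w) (x := x) (lvl₀ := s.col 6)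
        (by rw [h0, hv]; exact hk) t1.ne' t2 hx (by rw [h0, h11, h5, h2]; exact hI1)
        (by rw [h11]; exact hI2)
      rw [h0, h11, h5, h2] at j1
      rw [h11] at j2
      rw [h0, h2] at j4
      refine ⟨j1, j2, fun v hvk hlv y hy u hu hA => ?_⟩
      by_cases hve : v = k
      · subst hve
        refine j4 u hu ?_
        have e : s'.col 5 v = x + 1 := hv ▸ hx
        rw [h5, hy] at e
        rwa [← Nat.succ_injective e]
      · exact j3 u (hI3 v (by omega) hlv y hy u hu hA)
    · refine ⟨hI1, hI2, fun v hvk hlv y hy u hu hA => ?_⟩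
      by_cases hve : v = k
      · subst hve
        refine absurd ?_ ht
        have e1 : s'.col 6 v = s.col 6 v := by
          rcases hI2 v with h | h
          · exact h
          · exact absurd h.1 hlv
        have e2 := htree.le v hk
        have e3 : s'.col 5 v = y + 1 := by rw [h5, hy]
        simp only [Test.Holds, NExp.eval, hv, h11]
        simp only [State.col] at *
        omega
      · exact hI3 v (by omega) hlv y hy u hu hA

/-- A round either marks a new job or finds the marked set already closed under `Reach`. With `m`
jobs, after `m` rounds the set is closed or contains every job. -/
theorem den_search (s : State) :
    SearchTree s.Adj (s.nat 0 0 0) (s.col 5) (s.nat 10 0 0) (s.nat 0 0 0 + 1)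
      ((search.den s).col 6) ((search.den s).col 7) ∧
    ∀ u < s.nat 0 0 0, (search.den s).col 6 u ≠ 0 ↔
      Reach s.Adj (s.nat 0 0 0) (s.col 5) (s.nat 10 0 0) u := by
  have hf0 := searchInit.frame s
  have h0 : (searchInit.den s).nat 0 = s.nat 0 := hf0.nat 0 (by decide)
  have h5 : (searchInit.den s).col 5 = s.col 5 := hf0.col 5 (by decide)
  have h2 : (searchInit.den s).Adj = s.Adj := hf0.adj (by decide)
  have hinit := den_searchInit s
  have H := den_forTo (v := 11) (a := 0) (s := searchInit.den s) (p := searchRound) (by decide)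
    (fun k s' => (SearchTree s.Adj (s.nat 0 0 0) (s.col 5) (s.nat 10 0 0) (k + 1) (s'.col 6)
      (s'.col 7)) ∧ ((∀ u, Reach s.Adj (s.nat 0 0 0) (s.col 5) (s.nat 10 0 0) u → s'.col 6 u ≠ 0) ∨
        k ≤ ((Finset.range (s.nat 0 0 0)).filter fun u => s'.col 6 u ≠ 0).card))
    ?_ ⟨hinit, Or.inr (Nat.zero_le _)⟩ ?_
  · rw [h0] at H
    refine ⟨H.1, fun u hu => ⟨fun hl => H.1.reach hu hl, fun hr => ?_⟩⟩
    rcases H.2 with h | h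
    · exact h u hr
    · have := Finset.eq_of_subset_of_card_le (Finset.filter_subset _ _)
        ((Finset.card_range _).trans_le h)
      have hu' := Finset.mem_range.2 hu
      rw [← this] at hu'
      exact (Finset.mem_filter.1 hu').2
  · intro k s' j h
    rwa [State.col_writeNat_of_ne _ _ _ _ (by decide), State.col_writeNat_of_ne _ _ _ _ (by decide)]
  · rintro k hk s' hf hv ⟨hI1, hI2⟩
    have h0' : s'.nat 0 = s.nat 0 := (hf.nat 0 (by decide)).trans h0
    have h5' : s'.col 5 = s.col 5 := (hf.col 5 (by decide)).trans h5
    have h2' : s'.Adj = s.Adj := (hf.adj (by decide)).trans h2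
    obtain ⟨j1, j2, j3⟩ := den_searchRound (s := s') (w := s.nat 10 0 0)
      (by rw [h0', h5', h2', hv]; exact hI1)
    rw [h0', h5', h2', hv] at j1
    rw [h0', h5', h2'] at j3
    refine ⟨j1, ?_⟩
    by_cases hfull : ∀ u, Reach s.Adj (s.nat 0 0 0) (s.col 5) (s.nat 10 0 0) u → s'.col 6 u ≠ 0
    · exact Or.inl fun u hu => j2 u (hfull u hu)
    · right
      have hk' := hI2.resolve_left hfull
      refine Nat.succ_le_of_lt (hk'.trans_lt (Finset.card_lt_card ?_))
      rw [Finset.ssubset_iff_of_subset (Finset.monotone_filter_right _ fun u _ => j2 u)]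
      by_contra hcon
      push Not at hcon
      -- If the round marks nothing new, induction on `Reach` shows that all reachable jobs were
      -- marked before it.
      refine hfull fun u hu => ?_
      induction hu with
      | base hu hA => exact hI1.root _ hu hA
      | @step u v x hvr hx hu hA ih =>
        have := hcon u (by simpa [hu] using j3 v hvr.lt ih x hx u hu hA)
        exact (Finset.mem_filter.1 this).2

end Prog

end RAM

/-! ## Augmenting a matching -/

namespace RAM

/-- `mate` describes a matching on the jobs with property `P`. -/
structure IsMatching (A : ℕ → ℕ → Prop) (m n : ℕ) (mate : ℕ → ℕ) (P : ℕ → Prop) : Prop where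
  edge : ∀ u < m, P u → ∀ x, mate u = x + 1 → x < n ∧ A u x
  inj : ∀ u < m, P u → ∀ v < m, P v → ∀ x, mate u = x + 1 → mate v = x + 1 → u = v

/-- All neighbours of `Z` are matched into `Z`. -/
def IsClosedSet (A : ℕ → ℕ → Prop) (m : ℕ) (mate : ℕ → ℕ) (Z : Set ℕ) : Prop :=
  ∀ u < m, ∀ a ∈ Z, A u a → ∃ b ∈ Z, mate u = b + 1

/-- `mate` is obtained from `mate₀` by changes that leave the job `u` to be matched anew. -/
structure Hole (A : ℕ → ℕ → Prop) (m n : ℕ) (mate₀ lvl : ℕ → ℕ) (u : ℕ) (mate : ℕ → ℕ) :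
    Prop where
  lt : u < m
  agree : ∀ v < m, lvl v < lvl u → mate v = mate₀ v
  matching : IsMatching A m n mate (· ≠ u)
  covered : ∀ x, (∃ v < m, v ≠ u ∧ mate v = x + 1) ↔ ∃ v < m, mate₀ v = x + 1
  closed : ∀ Z, IsClosedSet A m mate₀ Z → (∀ a ∈ Z, ¬ A u a) ∧
    ∀ v < m, (∃ a ∈ Z, A v a) → mate v = mate₀ v

/-- `mate` is obtained from `mate₀` by an augmentation that covers the machine `w`. -/
structure Augmented (A : ℕ → ℕ → Prop) (m n : ℕ) (mate₀ : ℕ → ℕ) (w : ℕ) (mate : ℕ → ℕ) :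
    Prop where
  matching : IsMatching A m n mate fun _ => True
  covered : ∀ x, (∃ v < m, mate v = x + 1) ↔ x = w ∨ ∃ v < m, mate₀ v = x + 1
  closed : ∀ Z, IsClosedSet A m mate₀ Z → IsClosedSet A m mate Z

/-- An unmatched job has no neighbour in a closed set, because such neighbours are matched into the
set. -/
theorem Hole.init {A : ℕ → ℕ → Prop} {m n : ℕ} {mate lvl : ℕ → ℕ} {u : ℕ}
    (h : IsMatching A m n mate fun _ => True) (hu : u < m) (h0 : mate u = 0) :
    Hole A m n mate lvl u mate := by
  refine ⟨hu, fun _ _ _ => rfl, ⟨fun v hv _ => h.edge v hv trivial,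
    fun v hv _ z hz _ => h.inj v hv trivial z hz trivial⟩, fun x => ⟨?_, ?_⟩, fun Z hZ =>
    ⟨fun a ha hA => ?_, fun _ _ _ => rfl⟩⟩
  · rintro ⟨v, hv, -, hx⟩
    exact ⟨v, hv, hx⟩
  · rintro ⟨v, hv, hx⟩
    refine ⟨v, hv, ?_, hx⟩
    rintro rfl
    omega
  · obtain ⟨b, -, hb⟩ := hZ u hu a ha hA
    omega

/-- The job `u` takes the machine `x` of its parent `v`, which becomes the hole. The parent has a
smaller level and so still has its original mate. If `v` had a neighbour in a closed set, then `x`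
would belong to that set, although `u` is adjacent to `x` and has no neighbour there: the path stays
away from closed sets. -/
theorem Hole.step {A : ℕ → ℕ → Prop} {m n : ℕ} {mate₀ lvl mate : ℕ → ℕ} {u v x : ℕ}
    (h : Hole A m n mate₀ lvl u mate) (hv : v < m) (hlt : lvl v < lvl u) (hx : mate₀ v = x + 1)
    (hA : A u x) : Hole A m n mate₀ lvl v (Function.update mate u (x + 1)) := by
  have hvu : v ≠ u := by
    rintro rfl
    omega
  have hmv : mate v = x + 1 := (h.agree v hv hlt).trans hx
  have hux : ∀ z < m, z ≠ u → mate z = x + 1 → z = v := fun z hz hzu hzx =>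
    h.matching.inj z hz hzu v hv hvu x hzx hmv
  refine ⟨hv, fun z hz hzv => ?_, ⟨fun z hz hzv y hy => ?_, fun z hz hzv z' hz' hzv' y hy hy' => ?_⟩,
    fun y => ⟨?_, fun hy => ?_⟩, fun Z hZ => ?_⟩
  · have hzu : z ≠ u := by
      rintro rfl
      omega
    rw [Function.update_of_ne hzu]
    exact h.agree z hz (hzv.trans hlt)
  · by_cases hzu : z = u
    · subst hzu
      rw [Function.update_self] at hy
      obtain rfl := Nat.succ_injective hy
      exact ⟨(h.matching.edge v hv hvu x hmv).1, hA⟩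
    · rw [Function.update_of_ne hzu] at hy
      exact h.matching.edge z hz hzu y hy
  · by_cases hzu : z = u <;> by_cases hzu' : z' = u
    · rw [hzu, hzu']
    · subst hzu
      rw [Function.update_self] at hy
      rw [Function.update_of_ne hzu', ← hy] at hy'
      exact absurd (hux z' hz' hzu' hy') hzv'
    · subst hzu'
      rw [Function.update_self] at hy'
      rw [Function.update_of_ne hzu, ← hy'] at hy
      exact absurd (hux z hz hzu hy) hzv
    · rw [Function.update_of_ne hzu] at hy
      rw [Function.update_of_ne hzu'] at hy'
      exact h.matching.inj z hz hzu z' hz' hzu' y hy hy'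
  · rintro ⟨z, hz, hzv, hy⟩
    by_cases hzu : z = u
    · subst hzu
      rw [Function.update_self] at hy
      exact ⟨v, hv, hx.trans hy⟩
    · rw [Function.update_of_ne hzu] at hy
      exact (h.covered y).1 ⟨z, hz, hzu, hy⟩
  · obtain ⟨z, hz, hzu, hzy⟩ := (h.covered y).2 hy
    by_cases hzv : z = v
    · subst hzv
      exact ⟨u, h.lt, hvu.symm, by rw [Function.update_self, ← hzy, hmv]⟩
    · exact ⟨z, hz, hzv, by rwa [Function.update_of_ne hzu]⟩
  · obtain ⟨h1, h2⟩ := h.closed Z hZ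
    refine ⟨fun a ha hva => ?_, fun z hz hzZ => ?_⟩
    · obtain ⟨b, hb, hvb⟩ := hZ v hv a ha hva
      obtain rfl := Nat.succ_injective (hx.symm.trans hvb)
      exact h1 _ hb hA
    · have hzu : z ≠ u := by
        rintro rfl
        obtain ⟨a, ha, hza⟩ := hzZ
        exact h1 a ha hza
      rw [Function.update_of_ne hzu]
      exact h2 z hz hzZ

/-- The covered machines have not changed up to here, so `w` is still free and closes the hole. Jobs
adjacent to a closed set were never rematched, which keeps that set closed. -/
theorem Hole.fill {A : ℕ → ℕ → Prop} {m n : ℕ} {mate₀ lvl mate : ℕ → ℕ} {u w : ℕ}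
    (h : Hole A m n mate₀ lvl u mate) (hw : w < n) (hfree : ∀ v < m, mate₀ v ≠ w + 1)
    (hA : A u w) : Augmented A m n mate₀ w (Function.update mate u (w + 1)) := by
  have hfree' : ∀ z < m, z ≠ u → mate z ≠ w + 1 := by
    intro z hz hzu hzw
    obtain ⟨v, hv, hvw⟩ := (h.covered w).1 ⟨z, hz, hzu, hzw⟩
    exact hfree v hv hvw
  refine ⟨⟨fun z hz _ y hy => ?_, fun z hz _ z' hz' _ y hy hy' => ?_⟩, fun y => ⟨?_, ?_⟩,
    fun Z hZ z hz a ha hza => ?_⟩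
  · by_cases hzu : z = u
    · subst hzu
      rw [Function.update_self] at hy
      obtain rfl := Nat.succ_injective hy
      exact ⟨hw, hA⟩
    · rw [Function.update_of_ne hzu] at hy
      exact h.matching.edge z hz hzu y hy
  · by_cases hzu : z = u <;> by_cases hzu' : z' = u
    · rw [hzu, hzu']
    · subst hzu
      rw [Function.update_self] at hy
      rw [Function.update_of_ne hzu', ← hy] at hy'
      exact absurd hy' (hfree' z' hz' hzu')
    · subst hzu'
      rw [Function.update_self] at hy'
      rw [Function.update_of_ne hzu, ← hy'] at hy
      exact absurd hy (hfree' z hz hzu)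
    · rw [Function.update_of_ne hzu] at hy
      rw [Function.update_of_ne hzu'] at hy'
      exact h.matching.inj z hz hzu z' hz' hzu' y hy hy'
  · rintro ⟨z, hz, hy⟩
    by_cases hzu : z = u
    · subst hzu
      rw [Function.update_self] at hy
      exact Or.inl (Nat.succ_injective hy).symm
    · rw [Function.update_of_ne hzu] at hy
      exact Or.inr ((h.covered y).1 ⟨z, hz, hzu, hy⟩)
  · rintro (rfl | hy)
    · exact ⟨u, h.lt, Function.update_self _ _ _⟩
    · obtain ⟨z, hz, hzu, hzy⟩ := (h.covered y).2 hy
      exact ⟨z, hz, by rwa [Function.update_of_ne hzu]⟩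
  · obtain ⟨h1, h2⟩ := h.closed Z hZ
    have hzu : z ≠ u := by
      rintro rfl
      exact h1 a ha hza
    rw [Function.update_of_ne hzu, h2 z hz ⟨a, ha, hza⟩]
    exact hZ z hz a ha hza

/-- The assertion that holds after `k` steps along an augmenting path; `cur = u + 1` if the job `u`
is to be matched anew. -/
def AugmentInv (A : ℕ → ℕ → Prop) (m n : ℕ) (mate₀ lvl : ℕ → ℕ) (w k cur : ℕ) (mate : ℕ → ℕ) :
    Prop :=
  (cur = 0 ∧ Augmented A m n mate₀ w mate) ∨
    ∃ u, cur = u + 1 ∧ lvl u ≠ 0 ∧ lvl u + k ≤ m + 1 ∧ Hole A m n mate₀ lvl u mate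

namespace Prog

/-- Makes a step along the augmenting path. -/
def augmentStep : Prog :=
  when (.natLt (.const 0) (.var 16))
    (.cond (.natEq (.col 7 (.sub (.var 16) (.const 1))) (.const 0))
      (.seq (setCol 5 (.sub (.var 16) (.const 1)) (.add (.var 10) (.const 1)))
        (setVar 16 (.const 0)))
      (.seq (setCol 5 (.sub (.var 16) (.const 1))
          (.col 5 (.sub (.col 7 (.sub (.var 16) (.const 1))) (.const 1))))
        (setVar 16 (.col 7 (.sub (.var 16) (.const 1))))))

/-- Augments the matching along the path that starts at the job in variable `16`. -/
def augment : Prog :=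
  .seq augmentStep (.forTo 20 0 augmentStep)

theorem den_augmentStep {s : State} {A : ℕ → ℕ → Prop} {m n : ℕ} {mate₀ : ℕ → ℕ} {w B k : ℕ}
    (hw : w < n) (hs : s.nat 10 0 0 = w) (hfree : ∀ v < m, mate₀ v ≠ w + 1)
    (htree : SearchTree A m mate₀ w B (s.col 6) (s.col 7))
    (h : AugmentInv A m n mate₀ (s.col 6) w k (s.nat 16 0 0) (s.col 5)) :
    AugmentInv A m n mate₀ (s.col 6) w (k + 1) ((augmentStep.den s).nat 16 0 0)
      ((augmentStep.den s).col 5) := by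
  rw [augmentStep]
  rcases h with ⟨h0, h⟩ | ⟨u, hu, hl, hk, h⟩
  · rw [den_when_of_not (by simp [Test.Holds, NExp.eval, h0])]
    exact Or.inl ⟨h0, h⟩
  · rw [den_cond_of (by simp [Test.Holds, NExp.eval, hu])]
    rcases htree.parent u h.lt hl with ⟨hp, hA⟩ | ⟨v, x, hv, hp, hlv, hlt, hx, hA⟩
    · have hp' : s.nat 7 u 0 = 0 := hp
      rw [den_cond_of (by simp [Test.Holds, NExp.eval, hu, hp'])]
      simp only [den, NExp.eval, hu, Nat.add_sub_cancel]
      refine Or.inl ⟨by simp, ?_⟩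
      rw [State.col_writeNat_of_ne _ _ _ _ (by decide), State.col_writeNat_self, hs]
      exact h.fill hw hfree hA
    · have hp' : s.nat 7 u 0 = v + 1 := hp
      have hmv : s.nat 5 v 0 = x + 1 := (h.agree v hv hlt).trans hx
      rw [den_cond_of_not (by simp [Test.Holds, NExp.eval, hu, hp'])]
      simp only [den, NExp.eval, hu, Nat.add_sub_cancel]
      refine Or.inr ⟨v, by simp [hu, hp'], hlv, by omega, ?_⟩
      rw [State.col_writeNat_of_ne _ _ _ _ (by decide), State.col_writeNat_self, hp',
        Nat.add_sub_cancel, hmv]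
      exact h.step hv hlt hx hA

/-- Levels are at most `m + 1` and drop with every step. After the `m + 1` steps made here, an
unfinished path would have its hole at a job of level `0`, which `AugmentInv` excludes. -/
theorem den_augment {s : State} {n w u : ℕ} (hw : w < n) (hs : s.nat 10 0 0 = w)
    (hfree : ∀ v < s.nat 0 0 0, s.col 5 v ≠ w + 1)
    (hM : IsMatching s.Adj (s.nat 0 0 0) n (s.col 5) fun _ => True)
    (htree : SearchTree s.Adj (s.nat 0 0 0) (s.col 5) w (s.nat 0 0 0 + 1) (s.col 6) (s.col 7))
    (hcur : s.nat 16 0 0 = u + 1) (hu : u < s.nat 0 0 0) (hl : s.col 6 u ≠ 0)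
    (h0 : s.col 5 u = 0) :
    Augmented s.Adj (s.nat 0 0 0) n (s.col 5) w ((augment.den s).col 5) := by
  have hf := augmentStep.frame s
  have h1 := den_augmentStep (k := 0) hw hs hfree htree
    (Or.inr ⟨u, hcur, hl, htree.le u hu, .init hM hu h0⟩)
  have e0 : (augmentStep.den s).nat 0 = s.nat 0 := hf.nat 0 (by decide)
  have H := den_forTo (v := 20) (a := 0) (s := augmentStep.den s) (p := augmentStep) (by decide)
    (fun k s' => AugmentInv s.Adj (s.nat 0 0 0) n (s.col 5) (s.col 6) w (k + 1) (s'.nat 16 0 0)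
      (s'.col 5)) ?_ h1 ?_
  · rcases H with ⟨-, h⟩ | ⟨z, -, hz, hz', -⟩
    · exact h
    · rw [e0] at hz'
      omega
  · intro k s' j h
    rwa [State.col_writeNat_of_ne _ _ _ _ (by decide), State.writeNat_nat_of_ne _ (by decide)]
  · intro k _ s' hf' _ hI
    have e6 : s'.col 6 = s.col 6 := (hf'.col 6 (by decide)).trans (hf.col 6 (by decide))
    have e7 : s'.col 7 = s.col 7 := (hf'.col 7 (by decide)).trans (hf.col 7 (by decide))
    have e10 : s'.nat 10 = s.nat 10 := (hf'.nat 10 (by decide)).trans (hf.nat 10 (by decide))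
    have := den_augmentStep (s := s') hw (by rw [e10]; exact hs) hfree
      (by rw [e6, e7]; exact htree) (by rw [e6]; exact hI)
    rwa [e6] at this

end Prog

/-! ## Computing a minimum-cost matching -/

/-- The assertion about the matching that is maintained while the machines are processed in the
order of their costs: `out` marks the matched and `proc` the processed machines. -/
structure MatchInv (A : ℕ → ℕ → Prop) (m n : ℕ) (c : ℕ → ℝ) (mate out proc : ℕ → ℕ) : Prop where
  matching : IsMatching A m n mate fun _ => True
  out_iff : ∀ x < n, out x = 1 ↔ ∃ u < m, mate u = x + 1
  proc_of_out : ∀ x < n, out x = 1 → proc x ≠ 0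
  order : ∀ x < n, ∀ y < n, proc x ≠ 0 → proc y = 0 → c x ≤ c y
  certificate : ∀ x < n, proc x ≠ 0 → out x ≠ 1 →
    ∃ Z : Set ℕ, x ∈ Z ∧ (∀ a ∈ Z, a < n ∧ c a ≤ c x) ∧ IsClosedSet A m mate Z

theorem MatchInv.order_update {A : ℕ → ℕ → Prop} {m n : ℕ} {c : ℕ → ℝ} {mate out proc : ℕ → ℕ}
    (h : MatchInv A m n c mate out proc) {w : ℕ} (hmin : ∀ y < n, proc y = 0 → c w ≤ c y) :
    ∀ x < n, ∀ y < n, Function.update proc w 1 x ≠ 0 → Function.update proc w 1 y = 0 →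
      c x ≤ c y := by
  intro x hx y hy hpx hpy
  have hyw : y ≠ w := by
    rintro rfl
    simp at hpy
  rw [Function.update_of_ne hyw] at hpy
  by_cases hxw : x = w
  · rw [hxw]
    exact hmin y hy hpy
  · rw [Function.update_of_ne hxw] at hpx
    exact h.order x hx y hy hpx hpy

theorem MatchInv.free {A : ℕ → ℕ → Prop} {m n : ℕ} {c : ℕ → ℝ} {mate out proc : ℕ → ℕ}
    (h : MatchInv A m n c mate out proc) {w : ℕ} (hw : w < n) (hp : proc w = 0) :
    ∀ v < m, mate v ≠ w + 1 := fun v hv hvw =>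
  h.proc_of_out w hw ((h.out_iff w hw).2 ⟨v, hv, hvw⟩) hp

/-- The certificate of the rejected machine consists of itself and the mates of all jobs reached
from it. It is closed since no unmatched job is reached; its machines are no more expensive since
covered machines were processed earlier. -/
theorem MatchInv.reject {A : ℕ → ℕ → Prop} {m n : ℕ} {c : ℕ → ℝ} {mate out proc : ℕ → ℕ}
    (h : MatchInv A m n c mate out proc) {w : ℕ} (hw : w < n) (hp : proc w = 0)
    (hmin : ∀ y < n, proc y = 0 → c w ≤ c y) (hr : ∀ u, Reach A m mate w u → mate u ≠ 0) :
    MatchInv A m n c mate out (Function.update proc w 1) := by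
  refine ⟨h.matching, h.out_iff, fun x hx ho => ?_, h.order_update hmin, fun x hx hpx ho => ?_⟩
  · by_cases hxw : x = w
    · simp [hxw]
    · rw [Function.update_of_ne hxw]
      exact h.proc_of_out x hx ho
  · by_cases hxw : x = w
    · subst hxw
      refine ⟨{a | a = x ∨ ∃ u, Reach A m mate x u ∧ mate u = a + 1}, Or.inl rfl, ?_, ?_⟩
      · rintro a (rfl | ⟨u, hu, hua⟩)
        · exact ⟨hx, le_rfl⟩
        · have ha := (h.matching.edge u hu.lt trivial a hua).1
          exact ⟨ha, h.order a ha x hx (h.proc_of_out a ha ((h.out_iff a ha).2 ⟨u, hu.lt, hua⟩)) hp⟩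
      · have key : ∀ u, Reach A m mate x u →
            ∃ b ∈ {a | a = x ∨ ∃ u, Reach A m mate x u ∧ mate u = a + 1}, mate u = b + 1 := by
          intro u hu
          obtain ⟨b, hb⟩ := Nat.exists_eq_succ_of_ne_zero (hr u hu)
          exact ⟨b, Or.inr ⟨u, hu, hb⟩, hb⟩
        rintro u hu a (rfl | ⟨v, hv, hva⟩) hA
        · exact key u (.base hu hA)
        · exact key u (.step hv hva hu hA)
    · rw [Function.update_of_ne hxw] at hpx
      exact h.certificate x hx hpx ho

/-- Augmentation uncovers no machine and preserves closed sets, so the old certificates stay valid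
for the new matching. -/
theorem MatchInv.accept {A : ℕ → ℕ → Prop} {m n : ℕ} {c : ℕ → ℝ} {mate out proc : ℕ → ℕ}
    (h : MatchInv A m n c mate out proc) {w : ℕ} {mate' : ℕ → ℕ}
    (hmin : ∀ y < n, proc y = 0 → c w ≤ c y) (haug : Augmented A m n mate w mate') :
    MatchInv A m n c mate' (Function.update out w 1) (Function.update proc w 1) := by
  refine ⟨haug.matching, fun x hx => ?_, fun x hx ho => ?_, h.order_update hmin,
    fun x hx hpx ho => ?_⟩
  · rw [haug.covered]
    by_cases hxw : x = w
    · simp [hxw]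
    · simp [hxw, h.out_iff x hx]
  · by_cases hxw : x = w
    · simp [hxw]
    · rw [Function.update_of_ne hxw] at ho ⊢
      exact h.proc_of_out x hx ho
  · have hxw : x ≠ w := by
      rintro rfl
      simp at ho
    rw [Function.update_of_ne hxw] at ho hpx
    obtain ⟨Z, h1, h2, h3⟩ := h.certificate x hx hpx ho
    exact ⟨Z, h1, h2, haug.closed Z h3⟩

namespace Prog

/-- Selects an unprocessed machine `w` of minimum cost and sets variable `14` to `w + 1`. -/
def selectCheapest : Prog :=
  .seq (setVar 14 (.const 0))
    (.forTo 15 1 (when (.conj (.natEq (.col 8 (.var 15)) (.const 0))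
      (.neg (.conj (.natLt (.const 0) (.var 14))
        (.neg (.realLt (.get 0 (.var 15)) (.get 0 (.sub (.var 14) (.const 1))))))))
      (setVar 14 (.add (.var 15) (.const 1)))))

/-- Sets variable `16` to `u + 1` for an unmatched job `u` that the search has reached. -/
def findFree : Prog :=
  .seq (setVar 16 (.const 0))
    (.forTo 13 0 (when (.conj (.natLt (.const 0) (.col 6 (.var 13)))
      (.natEq (.col 5 (.var 13)) (.const 0)))
      (setVar 16 (.add (.var 13) (.const 1)))))

/-- Processes a machine. -/
def matchRound : Prog :=
  .seq selectCheapest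
    (when (.natLt (.const 0) (.var 14))
      (.seq (setVar 10 (.sub (.var 14) (.const 1)))
        (.seq (setCol 8 (.var 10) (.const 1))
          (.seq search
            (.seq findFree
              (when (.natLt (.const 0) (.var 16))
                (.seq (setCol 4 (.var 10) (.const 1)) augment)))))))

/-- Computes a minimum-cost matching. -/
def minCostMatching : Prog :=
  .forTo 21 1 matchRound

/-- Array `8` marks processed machines. Variable `14` is shifted by one, and its value `0` says that
no candidate has been found, in which case the comparison of costs is bypassed. -/
theorem den_selectCheapest (s : State) :
    ((selectCheapest.den s).nat 14 0 0 = 0 ∧ ∀ w < s.nat 1 0 0, s.col 8 w ≠ 0) ∨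
    ∃ w < s.nat 1 0 0, (selectCheapest.den s).nat 14 0 0 = w + 1 ∧ s.col 8 w = 0 ∧
      ∀ y < s.nat 1 0 0, s.col 8 y = 0 → s.real 0 w ≤ s.real 0 y := by
  have H := den_forTo (v := 15) (a := 1) (s := (setVar 14 (.const 0)).den s) (p := when
    (.conj (.natEq (.col 8 (.var 15)) (.const 0))
      (.neg (.conj (.natLt (.const 0) (.var 14))
        (.neg (.realLt (.get 0 (.var 15)) (.get 0 (.sub (.var 14) (.const 1))))))))
      (setVar 14 (.add (.var 15) (.const 1)))) (by decide)
    (fun k s' => (s'.nat 14 0 0 = 0 ∧ ∀ w < k, s.col 8 w ≠ 0) ∨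
      ∃ w < k, s'.nat 14 0 0 = w + 1 ∧ s.col 8 w = 0 ∧
      ∀ y < k, s.col 8 y = 0 → s.real 0 w ≤ s.real 0 y) ?_ (by simp [den, NExp.eval]) ?_
  · exact H
  · intro k s' j h
    rwa [State.writeNat_nat_of_ne _ (by decide)]
  · intro k hk s' hf hv hI
    have h8 : s'.nat 8 = s.nat 8 := (hf.nat 8 (by decide)).trans
      ((Prog.frame _ s).nat 8 (by decide))
    have hr : s'.real 0 = s.real 0 := hf.real 0 (by decide)
    simp only [den, Test.Holds, NExp.eval, RExp.eval, hv, h8, hr]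
    split_ifs with ht
    · obtain ⟨t1, t2⟩ := ht
      right
      refine ⟨k, by omega, by simp, t1, fun y hy hy8 => ?_⟩
      by_cases hyk : y = k
      · rw [hyk]
      · rcases hI with ⟨-, h⟩ | ⟨w, hw, h1, h2, h3⟩
        · exact absurd hy8 (h y (by omega))
        · rw [h1, Nat.add_sub_cancel] at t2
          push Not at t2
          exact (t2 (by omega)).le.trans (h3 y (by omega) hy8)
    · rcases hI with ⟨h0, h⟩ | ⟨w, hw, h1, h2, h3⟩
      · refine Or.inl ⟨h0, fun y hy hy8 => ?_⟩
        by_cases hyk : y = k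
        · subst hyk
          exact ht ⟨hy8, fun h => by omega⟩
        · exact h y (by omega) hy8
      · refine Or.inr ⟨w, by omega, h1, h2, fun y hy hy8 => ?_⟩
        by_cases hyk : y = k
        · subst hyk
          by_contra hcon
          refine ht ⟨hy8, fun h => h.2 ?_⟩
          rw [h1, Nat.add_sub_cancel]
          exact not_le.1 hcon
        · exact h3 y (by omega) hy8

theorem den_findFree (s : State) :
    ((findFree.den s).nat 16 0 0 = 0 ∧ ∀ u < s.nat 0 0 0, s.col 6 u ≠ 0 → s.col 5 u ≠ 0) ∨
    ∃ u < s.nat 0 0 0, (findFree.den s).nat 16 0 0 = u + 1 ∧ s.col 6 u ≠ 0 ∧ s.col 5 u = 0 := by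
  have H := den_forTo (v := 13) (a := 0) (s := (setVar 16 (.const 0)).den s) (p := when
    (.conj (.natLt (.const 0) (.col 6 (.var 13))) (.natEq (.col 5 (.var 13)) (.const 0)))
      (setVar 16 (.add (.var 13) (.const 1)))) (by decide)
    (fun k s' => (s'.nat 16 0 0 = 0 ∧ ∀ u < k, s.col 6 u ≠ 0 → s.col 5 u ≠ 0) ∨
    ∃ u < k, s'.nat 16 0 0 = u + 1 ∧ s.col 6 u ≠ 0 ∧ s.col 5 u = 0) ?_
      (by simp [den, NExp.eval]) ?_
  · exact H
  · intro k s' j h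
    rwa [State.writeNat_nat_of_ne _ (by decide)]
  · intro k hk s' hf hv hI
    have h5 : s'.nat 5 = s.nat 5 := (hf.nat 5 (by decide)).trans
      ((Prog.frame _ s).nat 5 (by decide))
    have h6 : s'.nat 6 = s.nat 6 := (hf.nat 6 (by decide)).trans
      ((Prog.frame _ s).nat 6 (by decide))
    simp only [den, Test.Holds, NExp.eval, hv, h5, h6]
    split_ifs with ht
    · exact Or.inr ⟨k, by omega, by simp, ht.1.ne', ht.2⟩
    · rcases hI with ⟨h0, h⟩ | ⟨u, hu, h1⟩
      · refine Or.inl ⟨h0, fun y hy hy6 hy5 => ?_⟩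
        by_cases hyk : y = k
        · subst hyk
          exact ht ⟨Nat.pos_of_ne_zero hy6, hy5⟩
        · exact h y (by omega) hy6 hy5
      · exact Or.inr ⟨u, by omega, h1⟩

/-- The second conclusion measures progress: exactly one further machine is processed unless none is
left. This makes `n` rounds sufficient. -/
theorem den_matchRound {s : State}
    (h : MatchInv s.Adj (s.nat 0 0 0) (s.nat 1 0 0) (s.real 0) (s.col 5) (s.col 4) (s.col 8)) :
    MatchInv s.Adj (s.nat 0 0 0) (s.nat 1 0 0) (s.real 0) ((matchRound.den s).col 5)
      ((matchRound.den s).col 4) ((matchRound.den s).col 8) ∧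
    ((∀ w < s.nat 1 0 0, s.col 8 w ≠ 0) ∧ (matchRound.den s).col 8 = s.col 8 ∨
      ∃ w < s.nat 1 0 0, s.col 8 w = 0 ∧
        (matchRound.den s).col 8 = Function.update (s.col 8) w 1) := by
  have hf1 := selectCheapest.frame s
  have hsel := den_selectCheapest s
  rw [matchRound, den_seq]
  generalize selectCheapest.den s = s₁ at hf1 hsel
  rcases hsel with ⟨h0, hall⟩ | ⟨w, hw, h1, hp, hmin⟩
  · rw [den_when_of_not (by simp [Test.Holds, NExp.eval, h0]), hf1.col 5 (by decide),
      hf1.col 4 (by decide), hf1.col 8 (by decide)]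
    exact ⟨h, Or.inl ⟨hall, rfl⟩⟩
  · rw [den_cond_of (by simp [Test.Holds, NExp.eval, h1]), den_seq, den_seq]
    have e1 : (setCol 8 (.var 10) (.const 1)).den ((setVar 10 (.sub (.var 14) (.const 1))).den s₁) =
        (s₁.writeNat 10 0 0 w).writeNat 8 w 0 1 := by
      simp [den, NExp.eval, h1]
    rw [e1, den_seq, den_seq]
    set s₂ := (s₁.writeNat 10 0 0 w).writeNat 8 w 0 1 with hs₂
    have hnat : ∀ b, b ∉ 10 :: 8 :: selectCheapest.natWrites → s₂.nat b = s.nat b := by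
      intro b hb
      simp only [List.mem_cons, not_or] at hb
      rw [hs₂, State.writeNat_nat_of_ne _ hb.2.1, State.writeNat_nat_of_ne _ hb.1]
      exact hf1.nat b hb.2.2
    have hcol : ∀ b, b ∉ 10 :: 8 :: selectCheapest.natWrites → s₂.col b = s.col b := by
      intro b hb
      funext i
      simp only [State.col, hnat b hb]
    have hadj : s₂.Adj = s.Adj := by
      funext u x
      simp only [State.Adj, hnat 2 (by decide)]
    have h8 : s₂.col 8 = Function.update (s.col 8) w 1 := by
      rw [hs₂, State.col_writeNat_self, State.col_writeNat_of_ne _ _ _ _ (by decide),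
        hf1.col 8 (by decide)]
    have h10 : s₂.nat 10 0 0 = w := by simp [hs₂]
    have h0 := hnat 0 (by decide)
    have hf2 := search.frame s₂
    obtain ⟨htree, hreach⟩ := den_search s₂
    generalize search.den s₂ = s₃ at hf2 htree hreach
    rw [h0, hadj, hcol 5 (by decide), h10] at htree hreach
    have hf3 := findFree.frame s₃
    have hfind := den_findFree s₃
    generalize findFree.den s₃ = s₄ at hf3 hfind
    have e5 : s₄.col 5 = s.col 5 := (hf3.col 5 (by decide)).trans
      ((hf2.col 5 (by decide)).trans (hcol 5 (by decide)))
    have e4 : s₄.col 4 = s.col 4 := (hf3.col 4 (by decide)).trans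
      ((hf2.col 4 (by decide)).trans (hcol 4 (by decide)))
    have e8 : s₄.col 8 = Function.update (s.col 8) w 1 := (hf3.col 8 (by decide)).trans
      ((hf2.col 8 (by decide)).trans h8)
    rw [hf2.nat 0 (by decide), h0, hf2.col 5 (by decide), hcol 5 (by decide)] at hfind
    rcases hfind with ⟨h0', hall⟩ | ⟨u, hu, h1', hl, hm⟩
    · rw [den_when_of_not (by simp [Test.Holds, NExp.eval, h0']), e5, e4, e8]
      exact ⟨h.reject hw hp hmin fun u hu => hall u hu.lt ((hreach u hu.lt).2 hu),
        Or.inr ⟨w, hw, hp, rfl⟩⟩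
    · rw [den_cond_of (by simp [Test.Holds, NExp.eval, h1']), den_seq]
      have h10' : s₄.nat 10 0 0 = w := by
        rw [hf3.nat 10 (by decide), hf2.nat 10 (by decide), h10]
      have e2 : (setCol 4 (.var 10) (.const 1)).den s₄ = s₄.writeNat 4 w 0 1 := by
        simp [den, NExp.eval, h10']
      rw [e2]
      set s₅ := s₄.writeNat 4 w 0 1 with hs₅
      have hnat5 : ∀ b, b ≠ 4 → s₅.nat b = s₄.nat b := fun b hb =>
        State.writeNat_nat_of_ne _ hb
      have hcol5 : ∀ b, b ≠ 4 → s₅.col b = s₄.col b := fun b hb =>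
        State.col_writeNat_of_ne _ _ _ _ hb
      have h4 : s₅.col 4 = Function.update (s.col 4) w 1 := by
        rw [hs₅, State.col_writeNat_self, e4]
      have hadj5 : s₅.Adj = s.Adj := by
        rw [← hadj, ← hf2.adj (by decide), ← hf3.adj (by decide)]
        funext a b
        simp only [State.Adj, hnat5 2 (by decide)]
      have h05 : s₅.nat 0 = s.nat 0 := by
        rw [hnat5 0 (by decide), hf3.nat 0 (by decide), hf2.nat 0 (by decide), h0]
      have h55 : s₅.col 5 = s.col 5 := by rw [hcol5 5 (by decide), e5]
      have h65 : s₅.col 6 = s₃.col 6 := by rw [hcol5 6 (by decide), hf3.col 6 (by decide)]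
      have h75 : s₅.col 7 = s₃.col 7 := by rw [hcol5 7 (by decide), hf3.col 7 (by decide)]
      have haug := den_augment (s := s₅) (n := s.nat 1 0 0) (w := w) (u := u) hw
        (by rw [hnat5 10 (by decide), h10'])
        (by rw [h05, h55]; exact h.free hw hp) (by rw [hadj5, h05, h55]; exact h.matching)
        (by rw [hadj5, h05, h55, h65, h75]; exact htree)
        (by rw [hnat5 16 (by decide)]; exact h1') (by rw [h05]; exact hu)
        (by rw [h65]; exact hl) (by rw [h55]; exact hm)
      rw [hadj5, h05, h55] at haug
      have hf5 := augment.frame s₅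
      rw [hf5.col 4 (by decide), hf5.col 8 (by decide), hcol5 8 (by decide), e8, h4]
      exact ⟨h.accept hmin haug, Or.inr ⟨w, hw, hp, rfl⟩⟩

theorem den_minCostMatching {s : State} (h5 : ∀ u, s.col 5 u = 0) (h4 : ∀ x, s.col 4 x = 0)
    (h8 : ∀ x, s.col 8 x = 0) :
    MatchInv s.Adj (s.nat 0 0 0) (s.nat 1 0 0) (s.real 0) ((minCostMatching.den s).col 5)
      ((minCostMatching.den s).col 4) ((minCostMatching.den s).col 8) ∧
    ∀ x < s.nat 1 0 0, (minCostMatching.den s).col 8 x ≠ 0 := by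
  have H := den_forTo (v := 21) (a := 1) (s := s) (p := matchRound) (by decide)
    (fun k s' => MatchInv s.Adj (s.nat 0 0 0) (s.nat 1 0 0) (s.real 0) (s'.col 5)
      (s'.col 4) (s'.col 8) ∧
      k ≤ ((Finset.range (s.nat 1 0 0)).filter fun x => s'.col 8 x ≠ 0).card) ?_
      ⟨?_, Nat.zero_le _⟩ ?_
  · refine ⟨H.1, fun x hx => ?_⟩
    have := Finset.eq_of_subset_of_card_le (Finset.filter_subset _ _)
      ((Finset.card_range _).trans_le H.2)
    have hx' := Finset.mem_range.2 hx
    rw [← this] at hx'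
    exact (Finset.mem_filter.1 hx').2
  · intro k s' j h
    rwa [State.col_writeNat_of_ne _ _ _ _ (by decide), State.col_writeNat_of_ne _ _ _ _ (by decide),
      State.col_writeNat_of_ne _ _ _ _ (by decide)]
  · refine ⟨⟨fun u _ _ x hx => ?_, fun u _ _ v _ _ x hx => ?_⟩, fun x _ => ?_, fun x _ hx => ?_,
      fun x _ y _ hx => ?_, fun x _ hx => ?_⟩
    · simp [h5] at hx
    · simp [h5] at hx
    · simp [h4, h5]
    · simp [h4] at hx
    · simp [h8] at hx
    · simp [h8] at hx
  · rintro k hk s' hf - ⟨hI1, hI2⟩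
    have e0 : s'.nat 0 = s.nat 0 := hf.nat 0 (by decide)
    have e1 : s'.nat 1 = s.nat 1 := hf.nat 1 (by decide)
    have e2 : s'.Adj = s.Adj := hf.adj (by decide)
    have er : s'.real 0 = s.real 0 := hf.real 0 (by decide)
    obtain ⟨j1, j2⟩ := den_matchRound (s := s') (by rw [e0, e1, e2, er]; exact hI1)
    rw [e0, e1, e2, er] at j1
    refine ⟨j1, ?_⟩
    rw [e1] at j2
    rcases j2 with ⟨hall, heq⟩ | ⟨w, hw, hp, heq⟩
    · rw [heq, Finset.filter_true_of_mem fun x hx => hall x (Finset.mem_range.1 hx),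
        Finset.card_range]
      exact hk
    · rw [heq]
      refine Nat.succ_le_of_lt (hI2.trans_lt (Finset.card_lt_card ?_))
      rw [Finset.ssubset_iff_of_subset]
      · exact ⟨w, by simp [hw], by simp [hp]⟩
      · refine Finset.monotone_filter_right _ fun x _ hx => ?_
        have hxw : x ≠ w := by
          rintro rfl
          exact hx hp
        rwa [Function.update_of_ne hxw]

end Prog

end RAM

/-! ## Greedy covering -/

namespace RAM

open Classical in
/-- The number of remaining jobs that are reached from the machine `w`. -/
noncomputable def coverCount (A : ℕ → ℕ → Prop) (m : ℕ) (mate rem : ℕ → ℕ) (w : ℕ) : ℕ :=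
  ((Finset.range m).filter fun u => Reach A m mate w u ∧ rem u = 1).card

theorem coverCount_le (A : ℕ → ℕ → Prop) (m : ℕ) (mate rem : ℕ → ℕ) (w : ℕ) :
    coverCount A m mate rem w ≤ m := by
  classical
  exact (Finset.card_le_card (Finset.filter_subset _ _)).trans_eq (Finset.card_range m)

namespace Prog

/-- Marks the critical jobs in array `9`. -/
def initRemaining : Prog :=
  .forTo 13 0 (when (.natEq (.col 3 (.sub (.col 5 (.var 13)) (.const 1))) (.const 1))
    (setCol 9 (.var 13) (.const 1)))

/-- Counts the remaining jobs that the search has reached. -/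
def countNew : Prog :=
  .seq (setVar 18 (.const 0))
    (.forTo 13 0 (when (.conj (.natLt (.const 0) (.col 6 (.var 13)))
      (.natEq (.col 9 (.var 13)) (.const 1)))
      (setVar 18 (.add (.var 18) (.const 1)))))

/-- Computes multiples of the costs of two machines by repeated addition. -/
def scale : Prog :=
  .seq (.setReal 1 (.const 0) (.sub (.get 1 (.const 0)) (.get 1 (.const 0))))
    (.seq (.setReal 2 (.const 0) (.sub (.get 2 (.const 0)) (.get 2 (.const 0))))
      (.forTo 13 0 (.seq
        (when (.natLt (.var 13) (.var 19))
          (.setReal 1 (.const 0) (.add (.get 1 (.const 0)) (.get 0 (.var 10)))))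
        (when (.natLt (.var 13) (.var 18))
          (.setReal 2 (.const 0) (.add (.get 2 (.const 0))
            (.get 0 (.sub (.var 14) (.const 1)))))))))

/-- Compares the machine in variable `10` with the best machine found so far. -/
def updateBest : Prog :=
  when (.natLt (.const 0) (.var 18))
    (.seq scale
      (when (.neg (.conj (.natLt (.const 0) (.var 14))
          (.neg (.realLt (.get 1 (.const 0)) (.get 2 (.const 0))))))
        (.seq (setVar 14 (.add (.var 10) (.const 1))) (setVar 19 (.var 18)))))

/-- Selects an unused machine `w` of minimum cost per newly covered job and sets variable `14` to
`w + 1`. -/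
def greedySelect : Prog :=
  .seq (.seq (setVar 14 (.const 0)) (setVar 19 (.const 0)))
    (.forTo 15 1 (when (.neg (.natEq (.col 4 (.var 15)) (.const 1)))
      (.seq (setVar 10 (.var 15)) (.seq search (.seq countNew updateBest)))))

/-- Removes the jobs that the search has reached from the remaining jobs. -/
def removeCovered : Prog :=
  .forTo 13 0 (when (.natLt (.const 0) (.col 6 (.var 13))) (setCol 9 (.var 13) (.const 0)))

/-- A step of the greedy algorithm. -/
def coverRound : Prog :=
  .seq greedySelect
    (when (.natLt (.const 0) (.var 14))
      (.seq (setVar 10 (.sub (.var 14) (.const 1)))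
        (.seq search (.seq removeCovered (setCol 4 (.var 10) (.const 1))))))

/-- The whole algorithm. -/
def robustAssignment : Prog :=
  .seq minCostMatching (.seq initRemaining (.forTo 21 0 coverRound))

/-- For an unmatched job the truncated subtraction would point to machine `0`. This does no harm, as
the result is used only for a perfect matching. -/
theorem den_initRemaining {s : State} (h9 : ∀ u, s.col 9 u = 0) :
    ∀ u < s.nat 0 0 0, (initRemaining.den s).col 9 u = 1 ↔ s.col 3 (s.col 5 u - 1) = 1 := by
  refine (den_forTo (v := 13) (a := 0) (s := s) (by decide)
    (fun k s' => (∀ u < k, s'.col 9 u = 1 ↔ s.col 3 (s.col 5 u - 1) = 1) ∧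
      ∀ u, k ≤ u → s'.col 9 u = 0) ?_ ⟨by simp, fun u _ => h9 u⟩ ?_).1
  · intro k s' j h
    rwa [State.col_writeNat_of_ne _ _ _ _ (by decide)]
  · rintro k hk s' hf hv ⟨hI1, hI2⟩
    have h3 : s'.nat 3 = s.nat 3 := hf.nat 3 (by decide)
    have h5 : s'.nat 5 = s.nat 5 := hf.nat 5 (by decide)
    simp only [den, Test.Holds, NExp.eval, hv, h3, h5]
    split_ifs with ht
    · rw [State.col_writeNat_self]
      refine ⟨fun u hu => ?_, fun u hu => ?_⟩
      · by_cases huk : u = k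
        · subst huk
          rw [Function.update_self]
          exact ⟨fun _ => ht, fun _ => rfl⟩
        · rw [Function.update_of_ne huk]
          exact hI1 u (by omega)
      · rw [Function.update_of_ne (by omega)]
        exact hI2 u (by omega)
    · refine ⟨fun u hu => ?_, fun u hu => hI2 u (by omega)⟩
      by_cases huk : u = k
      · subst huk
        rw [hI2 u le_rfl]
        exact ⟨fun h => absurd h (by decide), fun h => absurd h ht⟩
      · exact hI1 u (by omega)

theorem den_countNew (s : State) : (countNew.den s).nat 18 0 0 =
    ((Finset.range (s.nat 0 0 0)).filter fun u => s.col 6 u ≠ 0 ∧ s.col 9 u = 1).card := by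
  refine den_forTo (v := 13) (a := 0) (s := (setVar 18 (.const 0)).den s) (by decide)
    (fun k s' => s'.nat 18 0 0 =
      ((Finset.range k).filter fun u => s.col 6 u ≠ 0 ∧ s.col 9 u = 1).card) ?_
      (by simp [den, NExp.eval]) ?_
  · intro k s' j h
    rwa [State.writeNat_nat_of_ne _ (by decide)]
  · rintro k hk s' hf hv hI
    have h6 : s'.nat 6 = s.nat 6 := (hf.nat 6 (by decide)).trans
      ((Prog.frame _ s).nat 6 (by decide))
    have h9 : s'.nat 9 = s.nat 9 := (hf.nat 9 (by decide)).trans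
      ((Prog.frame _ s).nat 9 (by decide))
    simp only [den, Test.Holds, NExp.eval, hv, h6, h9]
    rw [Finset.range_add_one, Finset.filter_insert]
    split_ifs with h1 h2 h2
    · rw [Finset.card_insert_of_notMem (by simp)]
      simp [hI]
    · exact absurd ⟨h1.1.ne', h1.2⟩ h2
    · exact absurd ⟨Nat.pos_of_ne_zero h2.1, h2.2⟩ h1
    · exact hI

/-- These are the two sides of the cross-multiplied comparison of ratios: each cost is added up as
often as the other machine's count says. Counts are at most `m`, so `m` rounds are enough. The
accumulators are cleared by `x - x`, as there are no real constants. -/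
theorem den_scale (s : State) (h18 : s.nat 18 0 0 ≤ s.nat 0 0 0)
    (h19 : s.nat 19 0 0 ≤ s.nat 0 0 0) :
    (scale.den s).real 1 0 = s.nat 19 0 0 * s.real 0 (s.nat 10 0 0) ∧
    (scale.den s).real 2 0 = s.nat 18 0 0 * s.real 0 (s.nat 14 0 0 - 1) := by
  set s₁ := (Prog.setReal 2 (.const 0) (.sub (.get 2 (.const 0)) (.get 2 (.const 0)))).den
    ((Prog.setReal 1 (.const 0) (.sub (.get 1 (.const 0)) (.get 1 (.const 0)))).den s) with hs₁
  have e0 : s₁.real 0 = s.real 0 := by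
    funext i
    simp [hs₁, den]
  have en : s₁.nat = s.nat := rfl
  have H := den_forTo (v := 13) (a := 0) (s := s₁) (p := .seq
        (when (.natLt (.var 13) (.var 19))
          (.setReal 1 (.const 0) (.add (.get 1 (.const 0)) (.get 0 (.var 10)))))
        (when (.natLt (.var 13) (.var 18))
          (.setReal 2 (.const 0) (.add (.get 2 (.const 0))
            (.get 0 (.sub (.var 14) (.const 1))))))) (by decide)
    (fun k s' => s'.real 1 0 = (min k (s.nat 19 0 0) : ℕ) * s.real 0 (s.nat 10 0 0) ∧
      s'.real 2 0 = (min k (s.nat 18 0 0) : ℕ) * s.real 0 (s.nat 14 0 0 - 1)) (fun _ _ _ h => h)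
    (by simp [hs₁, den, RExp.eval, NExp.eval]) ?_
  · rw [en, min_eq_right h18, min_eq_right h19] at H
    exact H
  · rintro k hk s' hf hv ⟨hI1, hI2⟩
    have f10 : s'.nat 10 = s.nat 10 := hf.nat 10 (by decide)
    have f14 : s'.nat 14 = s.nat 14 := hf.nat 14 (by decide)
    have f18 : s'.nat 18 = s.nat 18 := hf.nat 18 (by decide)
    have f19 : s'.nat 19 = s.nat 19 := hf.nat 19 (by decide)
    have fr : s'.real 0 = s.real 0 := (hf.real 0 (by decide)).trans e0
    have key : ∀ b : ℕ, ((min (k + 1) b : ℕ) : ℝ) = (min k b : ℕ) + if k < b then 1 else 0 := by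
      intro b
      split_ifs with h
      · rw [min_eq_left (by omega), min_eq_left h.le]
        push_cast
        ring
      · rw [min_eq_right (by omega), min_eq_right (by omega), add_zero]
    rw [key, key, add_mul, add_mul, ← hI1, ← hI2]
    by_cases h1 : k < s.nat 19 0 0 <;> by_cases h2 : k < s.nat 18 0 0 <;>
      simp [den, Test.Holds, NExp.eval, RExp.eval, hv, f10, f14, f18, f19, fr, h1, h2]

/-- The assertion about the best machine among those with property `P`; `g w` is the number of
jobs that the machine `w` newly covers. -/
def BestInv (P : ℕ → Prop) (g : ℕ → ℕ) (c : ℕ → ℝ) (b k : ℕ) : Prop :=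
  (b = 0 ∧ ∀ w, P w → g w = 0) ∨
    ∃ w, b = w + 1 ∧ k = g w ∧ P w ∧ 0 < g w ∧ ∀ y, P y → 0 < g y → g y * c w ≤ g w * c y

theorem BestInv.congr {P P' : ℕ → Prop} {g : ℕ → ℕ} {c : ℕ → ℝ} {b k : ℕ}
    (h : BestInv P g c b k) (hP : ∀ w, P w ↔ P' w) : BestInv P' g c b k := by
  rwa [← show P = P' from funext fun w => propext (hP w)]

/-- Variables `10` and `18` hold the current machine and its count, `14` and `19` the best machine
(shifted by one) and its count. Replacing the best machine uses transitivity of the comparison of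
ratios, with all counts involved positive. -/
theorem den_updateBest {s : State} {P : ℕ → Prop} {g : ℕ → ℕ}
    (hg : ∀ w, g w ≤ s.nat 0 0 0) (h18 : s.nat 18 0 0 = g (s.nat 10 0 0))
    (h : BestInv P g (s.real 0) (s.nat 14 0 0) (s.nat 19 0 0)) (h19 : s.nat 19 0 0 ≤ s.nat 0 0 0) :
    BestInv (fun w => P w ∨ w = s.nat 10 0 0) g (s.real 0) ((updateBest.den s).nat 14 0 0)
      ((updateBest.den s).nat 19 0 0) ∧
    (updateBest.den s).nat 19 0 0 ≤ s.nat 0 0 0 := by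
  rw [updateBest]
  by_cases h0 : 0 < s.nat 18 0 0
  · rw [den_cond_of (by simpa [Test.Holds, NExp.eval] using h0), den_seq]
    obtain ⟨hx, hy⟩ := den_scale s (h18 ▸ hg _) h19
    have hf := scale.frame s
    generalize scale.den s = s₁ at hx hy hf
    have e14 : s₁.nat 14 = s.nat 14 := hf.nat 14 (by decide)
    have e10 : s₁.nat 10 = s.nat 10 := hf.nat 10 (by decide)
    have e18 : s₁.nat 18 = s.nat 18 := hf.nat 18 (by decide)
    have e19 : s₁.nat 19 = s.nat 19 := hf.nat 19 (by decide)
    by_cases ht : 0 < s.nat 14 0 0 ∧ ¬ (s.nat 19 0 0 * s.real 0 (s.nat 10 0 0) <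
        s.nat 18 0 0 * s.real 0 (s.nat 14 0 0 - 1))
    · rw [den_when_of_not (by
        simp only [Test.Holds, NExp.eval, RExp.eval, hx, hy, e14]
        exact not_not.2 ht), e14, e19]
      refine ⟨?_, h19⟩
      rcases h with ⟨hb, -⟩ | ⟨w, hb, hk, hw, hgw, hmin⟩
      · omega
      · refine Or.inr ⟨w, hb, hk, Or.inl hw, hgw, ?_⟩
        rintro y (hy | rfl) hgy
        · exact hmin y hy hgy
        · have := not_lt.1 ht.2
          rwa [hb, hk, h18, Nat.add_sub_cancel] at this
    · rw [den_cond_of (by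
        simp only [Test.Holds, NExp.eval, RExp.eval, hx, hy, e14]
        exact ht)]
      have r14 : ((Prog.seq (setVar 14 (.add (.var 10) (.const 1))) (setVar 19 (.var 18))).den
          s₁).nat 14 0 0 = s.nat 10 0 0 + 1 := by
        simp [den, NExp.eval, e10]
      have r19 : ((Prog.seq (setVar 14 (.add (.var 10) (.const 1))) (setVar 19 (.var 18))).den
          s₁).nat 19 0 0 = s.nat 18 0 0 := by
        simp [den, NExp.eval, e18]
      rw [r14, r19, h18]
      rw [h18] at h0
      refine ⟨Or.inr ⟨_, rfl, rfl, Or.inr rfl, h0, ?_⟩, hg _⟩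
      rintro y (hy | rfl) hgy
      · rcases h with ⟨-, hb⟩ | ⟨w, hb, hk, hw, hgw, hmin⟩
        · have := hb y hy
          omega
        · have hlt : (g w : ℝ) * s.real 0 (s.nat 10 0 0) <
              g (s.nat 10 0 0) * s.real 0 w := by
            by_contra hcon
            exact ht ⟨by omega, by rwa [hb, hk, h18, Nat.add_sub_cancel]⟩
          have h1 := hmin y hy hgy
          have hw0 : (0 : ℝ) < g w := by exact_mod_cast hgw
          have hy0 : (0 : ℝ) < g y := by exact_mod_cast hgy
          have h3 : (0 : ℝ) < g (s.nat 10 0 0) := by exact_mod_cast h0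
          -- Transitivity of the ratio order through the former best machine `w`, whose positive
          -- count is cancelled.
          refine le_of_mul_le_mul_left ?_ hw0
          calc (g w : ℝ) * (g y * s.real 0 (s.nat 10 0 0))
              = g y * (g w * s.real 0 (s.nat 10 0 0)) := by ring
            _ ≤ g y * (g (s.nat 10 0 0) * s.real 0 w) := by gcongr
            _ = g (s.nat 10 0 0) * (g y * s.real 0 w) := by ring
            _ ≤ g (s.nat 10 0 0) * (g w * s.real 0 y) := by gcongr
            _ = g w * (g (s.nat 10 0 0) * s.real 0 y) := by ring
      · exact le_rfl
  · rw [den_when_of_not (by simpa [Test.Holds, NExp.eval] using h0)]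
    have hz : g (s.nat 10 0 0) = 0 := by omega
    refine ⟨?_, h19⟩
    rcases h with ⟨hb, hall⟩ | ⟨w, hb, hk, hw, hgw, hmin⟩
    · refine Or.inl ⟨hb, ?_⟩
      rintro w (hw | rfl)
      · exact hall w hw
      · exact hz
    · refine Or.inr ⟨w, hb, hk, Or.inl hw, hgw, ?_⟩
      rintro y (hy | rfl) hgy
      · exact hmin y hy hgy
      · omega

theorem den_greedySelect (s : State) :
    ∃ k, BestInv (fun w => w < s.nat 1 0 0 ∧ s.col 4 w ≠ 1)
      (coverCount s.Adj (s.nat 0 0 0) (s.col 5) (s.col 9)) (s.real 0)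
      ((greedySelect.den s).nat 14 0 0) k := by
  have hf0 := (Prog.seq (setVar 14 (.const 0)) (setVar 19 (.const 0))).frame s
  have z14 : ((Prog.seq (setVar 14 (.const 0)) (setVar 19 (.const 0))).den s).nat 14 0 0 = 0 := by
    simp [den, NExp.eval]
  have z19 : ((Prog.seq (setVar 14 (.const 0)) (setVar 19 (.const 0))).den s).nat 19 0 0 = 0 := by
    simp [den, NExp.eval]
  rw [greedySelect, den_seq]
  generalize (Prog.seq (setVar 14 (.const 0)) (setVar 19 (.const 0))).den s = s₀ at hf0 z14 z19
  have H := den_forTo (v := 15) (a := 1) (s := s₀) (p :=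
    (when (.neg (.natEq (.col 4 (.var 15)) (.const 1)))
      (.seq (setVar 10 (.var 15)) (.seq search (.seq countNew updateBest))))) (by decide)
    (fun k s' => BestInv (fun w => w < k ∧ s.col 4 w ≠ 1)
      (coverCount s.Adj (s.nat 0 0 0) (s.col 5) (s.col 9)) (s.real 0) (s'.nat 14 0 0)
      (s'.nat 19 0 0) ∧ s'.nat 19 0 0 ≤ s.nat 0 0 0) ?_ ?_ ?_
  · rw [hf0.nat 1 (by decide)] at H
    exact ⟨_, H.1⟩
  · intro k s' j h
    rwa [State.writeNat_nat_of_ne _ (by decide), State.writeNat_nat_of_ne _ (by decide)]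
  · exact ⟨Or.inl ⟨z14, by simp⟩, by omega⟩
  · rintro k hk s' hf hv ⟨hI1, hI2⟩
    have h4 : s'.col 4 = s.col 4 := (hf.col 4 (by decide)).trans (hf0.col 4 (by decide))
    by_cases ht : s.col 4 k = 1
    · rw [den_when_of_not (by
        simp only [Test.Holds, NExp.eval, hv]
        exact not_not.2 ((congrFun h4 k).trans ht))]
      refine ⟨hI1.congr fun w => ⟨fun h => ⟨by omega, h.2⟩, fun h => ⟨?_, h.2⟩⟩, hI2⟩
      have : w ≠ k := by
        rintro rfl
        exact h.2 ht
      omega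
    · rw [den_cond_of (by
        simp only [Test.Holds, NExp.eval, hv]
        exact fun h => ht ((congrFun h4 k).symm.trans h)), den_seq, den_seq, den_seq]
      have hf1 := (setVar 10 (.var 15)).frame s'
      have z10 : ((setVar 10 (.var 15)).den s').nat 10 0 0 = k := by
        simp [den, NExp.eval, hv]
      generalize (setVar 10 (.var 15)).den s' = s₁ at hf1 z10
      have hf2 := search.frame s₁
      obtain ⟨-, hr⟩ := den_search s₁
      generalize search.den s₁ = s₂ at hf2 hr
      have hf3 := countNew.frame s₂
      have hc := den_countNew s₂
      generalize countNew.den s₂ = s₃ at hf3 hc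
      have a0 : s₁.nat 0 = s.nat 0 := (hf1.nat 0 (by decide)).trans
        ((hf.nat 0 (by decide)).trans (hf0.nat 0 (by decide)))
      have a5 : s₁.col 5 = s.col 5 := (hf1.col 5 (by decide)).trans
        ((hf.col 5 (by decide)).trans (hf0.col 5 (by decide)))
      have aA : s₁.Adj = s.Adj := (hf1.adj (by decide)).trans
        ((hf.adj (by decide)).trans (hf0.adj (by decide)))
      have b0 : s₂.nat 0 = s.nat 0 := (hf2.nat 0 (by decide)).trans a0
      have b9 : s₂.col 9 = s.col 9 := (hf2.col 9 (by decide)).trans ((hf1.col 9 (by decide)).trans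
        ((hf.col 9 (by decide)).trans (hf0.col 9 (by decide))))
      have c0 : s₃.nat 0 = s.nat 0 := (hf3.nat 0 (by decide)).trans b0
      have c10 : s₃.nat 10 0 0 = k := by
        rw [hf3.nat 10 (by decide), hf2.nat 10 (by decide), z10]
      have c14 : s₃.nat 14 = s'.nat 14 := by
        rw [hf3.nat 14 (by decide), hf2.nat 14 (by decide), hf1.nat 14 (by decide)]
      have c19 : s₃.nat 19 = s'.nat 19 := by
        rw [hf3.nat 19 (by decide), hf2.nat 19 (by decide), hf1.nat 19 (by decide)]
      have cr : s₃.real 0 = s.real 0 := by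
        rw [hf3.real 0 (by decide), hf2.real 0 (by decide), hf1.real 0 (by decide),
          hf.real 0 (by decide), hf0.real 0 (by decide)]
      rw [a0, a5, aA, z10] at hr
      rw [b0, b9] at hc
      have hc' : s₃.nat 18 0 0 = coverCount s.Adj (s.nat 0 0 0) (s.col 5) (s.col 9) k := by
        classical
        rw [hc, coverCount]
        congr 1
        refine Finset.filter_congr fun u hu => ?_
        rw [hr u (Finset.mem_range.1 hu)]
      obtain ⟨j1, j2⟩ := den_updateBest (s := s₃)
        (P := fun w => w < k ∧ s.col 4 w ≠ 1)
        (g := coverCount s.Adj (s.nat 0 0 0) (s.col 5) (s.col 9))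
        (fun w => by rw [c0]; exact coverCount_le _ _ _ _ w) (by rw [c10]; exact hc')
        (by rw [c14, c19, cr]; exact hI1) (by rw [c19, c0]; exact hI2)
      rw [c10, cr] at j1
      rw [c0] at j2
      refine ⟨j1.congr fun w => ⟨?_, fun h => ?_⟩, j2⟩
      · rintro (h | rfl)
        · exact ⟨by omega, h.2⟩
        · exact ⟨by omega, ht⟩
      · by_cases hwk : w = k
        · exact Or.inr hwk
        · exact Or.inl ⟨by omega, h.2⟩

theorem den_removeCovered (s : State) :
    ∀ u < s.nat 0 0 0, (removeCovered.den s).col 9 u = if s.col 6 u ≠ 0 then 0 else s.col 9 u := by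
  refine (den_forTo (v := 13) (a := 0) (s := s) (by decide)
    (fun k s' => (∀ u < k, s'.col 9 u = if s.col 6 u ≠ 0 then 0 else s.col 9 u) ∧
      ∀ u, k ≤ u → s'.col 9 u = s.col 9 u) ?_ ⟨by simp, fun _ _ => rfl⟩ ?_).1
  · intro k s' j h
    rwa [State.col_writeNat_of_ne _ _ _ _ (by decide)]
  · rintro k hk s' hf hv ⟨hI1, hI2⟩
    have h6 : s'.col 6 = s.col 6 := hf.col 6 (by decide)
    by_cases ht : s.col 6 k = 0
    · rw [den_when_of_not (by
        simp only [Test.Holds, NExp.eval, hv]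
        exact fun h => h.ne' ((congrFun h6 k).trans ht))]
      refine ⟨fun u hu => ?_, fun u hu => hI2 u (by omega)⟩
      by_cases huk : u = k
      · subst huk
        rw [if_neg (by simpa using ht)]
        exact hI2 u le_rfl
      · exact hI1 u (by omega)
    · rw [den_cond_of (by
        simp only [Test.Holds, NExp.eval, hv]
        exact Nat.pos_of_ne_zero fun h => ht ((congrFun h6 k).symm.trans h))]
      simp only [den, NExp.eval, hv]
      rw [State.col_writeNat_self]
      refine ⟨fun u hu => ?_, fun u hu => ?_⟩
      · by_cases huk : u = k
        · subst huk
          simp [ht]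
        · rw [Function.update_of_ne huk]
          exact hI1 u (by omega)
      · rw [Function.update_of_ne (by omega)]
        exact hI2 u (by omega)

/-- The search is repeated for the selected machine, because the level array holds the result for
the machine tried last. Array `4` excludes both the matched and the previously selected machines
from the choice. -/
theorem den_coverRound (s : State) :
    ((coverRound.den s).col 4 = s.col 4 ∧ (coverRound.den s).col 9 = s.col 9 ∧
      ∀ w < s.nat 1 0 0, s.col 4 w ≠ 1 →
        coverCount s.Adj (s.nat 0 0 0) (s.col 5) (s.col 9) w = 0) ∨
    ∃ w < s.nat 1 0 0, s.col 4 w ≠ 1 ∧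
      0 < coverCount s.Adj (s.nat 0 0 0) (s.col 5) (s.col 9) w ∧
      (∀ y < s.nat 1 0 0, s.col 4 y ≠ 1 →
        0 < coverCount s.Adj (s.nat 0 0 0) (s.col 5) (s.col 9) y →
        coverCount s.Adj (s.nat 0 0 0) (s.col 5) (s.col 9) y * s.real 0 w ≤
          coverCount s.Adj (s.nat 0 0 0) (s.col 5) (s.col 9) w * s.real 0 y) ∧
      (coverRound.den s).col 4 = Function.update (s.col 4) w 1 ∧
      ∀ u < s.nat 0 0 0, (coverRound.den s).col 9 u = 1 ↔
        s.col 9 u = 1 ∧ ¬ Reach s.Adj (s.nat 0 0 0) (s.col 5) w u := by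
  have hf1 := greedySelect.frame s
  obtain ⟨k, hsel⟩ := den_greedySelect s
  rw [coverRound, den_seq]
  generalize greedySelect.den s = s₁ at hf1 hsel
  rcases hsel with ⟨h0, hall⟩ | ⟨w, hb, -, ⟨hw, hw4⟩, hgw, hmin⟩
  · left
    rw [den_when_of_not (by simp [Test.Holds, NExp.eval, h0])]
    exact ⟨hf1.col 4 (by decide), hf1.col 9 (by decide), fun w hw hw4 => hall w ⟨hw, hw4⟩⟩
  · right
    refine ⟨w, hw, hw4, hgw, fun y hy hy4 hgy => hmin y ⟨hy, hy4⟩ hgy, ?_⟩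
    rw [den_cond_of (by simp [Test.Holds, NExp.eval, hb]), den_seq, den_seq, den_seq]
    have hf2 := (setVar 10 (.sub (.var 14) (.const 1))).frame s₁
    have z10 : ((setVar 10 (.sub (.var 14) (.const 1))).den s₁).nat 10 0 0 = w := by
      simp [den, NExp.eval, hb]
    generalize (setVar 10 (.sub (.var 14) (.const 1))).den s₁ = s₂ at hf2 z10
    have hf3 := search.frame s₂
    obtain ⟨-, hr⟩ := den_search s₂
    generalize search.den s₂ = s₃ at hf3 hr
    have hf4 := removeCovered.frame s₃
    have hrem := den_removeCovered s₃
    generalize removeCovered.den s₃ = s₄ at hf4 hrem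
    have e10 : s₄.nat 10 0 0 = w := by
      rw [hf4.nat 10 (by decide), hf3.nat 10 (by decide), z10]
    have e : (setCol 4 (.var 10) (.const 1)).den s₄ = s₄.writeNat 4 w 0 1 := by
      simp [den, NExp.eval, e10]
    rw [e, State.col_writeNat_self, State.col_writeNat_of_ne _ _ _ _ (by decide),
      hf4.col 4 (by decide), hf3.col 4 (by decide), hf2.col 4 (by decide), hf1.col 4 (by decide)]
    refine ⟨rfl, fun u hu => ?_⟩
    rw [hf2.nat 0 (by decide), hf1.nat 0 (by decide), hf2.col 5 (by decide),
      hf1.col 5 (by decide), hf2.adj (by decide), hf1.adj (by decide), z10] at hr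
    rw [hf3.nat 0 (by decide), hf2.nat 0 (by decide), hf1.nat 0 (by decide),
      hf3.col 9 (by decide), hf2.col 9 (by decide), hf1.col 9 (by decide)] at hrem
    rw [hrem u hu, ← hr u hu]
    split_ifs with h
    · simp [h]
    · simp [h]

end Prog

end RAM

/-! ## Correctness of the program -/

namespace RAM

open VRAP

/-- The set of edges that an array of mates describes. -/
def edgesOfMate (m n : ℕ) (mate : ℕ → ℕ) : Finset (Fin m × Fin n) :=
  Finset.univ.filter fun e => mate e.1 = e.2 + 1

@[simp]
theorem mem_edgesOfMate {m n : ℕ} {mate : ℕ → ℕ} {u : Fin m} {w : Fin n} :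
    (u, w) ∈ edgesOfMate m n mate ↔ mate u = w + 1 := by
  simp [edgesOfMate]

/-! ### Translation between memory contents and the instance -/

section Instance

variable {m n : ℕ} (I : VRAP (Fin m) (Fin n))

theorem initial_adj (u : Fin m) (w : Fin n) : (initial I).Adj u w ↔ (u, w) ∈ I.E := by
  simp [State.Adj, initial, Fin.val_inj]

theorem initial_col_three (w : Fin n) : (initial I).col 3 w = 1 ↔ w ∈ I.F := by
  simp [State.col, initial, Fin.val_inj]

theorem initial_col {b : ℕ} (hb : 3 < b) (i : ℕ) : (initial I).col b i = 0 := by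
  have h0 : b ≠ 0 := by omega
  have h1 : b ≠ 1 := by omega
  have h2 : b ≠ 2 := by omega
  have h3 : b ≠ 3 := by omega
  simp [State.col, initial, h0, h1, h2, h3]

theorem initial_real (w : Fin n) : (initial I).real 0 w = I.c w := by
  simp [initial]

@[simp]
theorem initial_jobs : (initial I).nat 0 0 0 = m := by
  simp [initial]

@[simp]
theorem initial_machines : (initial I).nat 1 0 0 = n := by
  simp [initial]

variable {I} {mate : ℕ → ℕ}

/-- The search runs on natural numbers. The edge condition of a matching ensures that each mate met
on the way is the index of an actual machine. -/
theorem reach_iff_altReach (hM : IsMatching (initial I).Adj m n mate fun _ => True) (u : Fin m)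
    (w : Fin n) : Reach (initial I).Adj m mate w u ↔ AltReach I.E (edgesOfMate m n mate) w u := by
  constructor
  · suffices H : ∀ u, Reach (initial I).Adj m mate w u → ∀ v : Fin m, v.val = u →
        AltReach I.E (edgesOfMate m n mate) w v from fun h => H u h u rfl
    intro u hu
    induction hu with
    | base hu hA =>
      rintro v rfl
      exact .base ((initial_adj I v w).1 hA)
    | @step u v x hv hx hu hA ih =>
      rintro v' rfl
      have hxn := (hM.edge v hv.lt trivial x hx).1
      exact .step (ih ⟨v, hv.lt⟩ rfl) (mem_edgesOfMate (w := ⟨x, hxn⟩).2 hx)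
        ((initial_adj I v' ⟨x, hxn⟩).1 hA)
  · intro h
    induction h with
    | @base u h => exact .base u.isLt ((initial_adj I u w).2 h)
    | @step u v x hv hx hE ih =>
      exact .step ih (mem_edgesOfMate.1 hx) u.isLt ((initial_adj I u x).2 hE)

theorem MatchInv.isLocallyOptimal {out proc : ℕ → ℕ}
    (h : MatchInv (initial I).Adj m n ((initial I).real 0) mate out proc)
    (hproc : ∀ x < n, proc x ≠ 0) : IsLocallyOptimal I.E (edgesOfMate m n mate) I.c := by
  refine ⟨?_, fun u v x hu hv => ?_, fun u x y hx hy => ?_, fun w hw => ?_⟩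
  · rintro ⟨u, w⟩ he
    exact (initial_adj I u w).1
      (h.matching.edge u u.isLt trivial w (mem_edgesOfMate.1 he)).2
  · exact Fin.ext (h.matching.inj u u.isLt trivial v v.isLt trivial x (mem_edgesOfMate.1 hu)
      (mem_edgesOfMate.1 hv))
  · have h1 := mem_edgesOfMate.1 hx
    have h2 := mem_edgesOfMate.1 hy
    exact Fin.ext (by omega)
  · have hout : out w ≠ 1 := by
      intro ho
      obtain ⟨u, hu, huw⟩ := (h.out_iff w w.isLt).1 ho
      exact hw ⟨u, hu⟩ (mem_edgesOfMate.2 huw)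
    obtain ⟨Z, h1, h2, h3⟩ := h.certificate w w.isLt (hproc w w.isLt) hout
    refine ⟨{x | x.val ∈ Z}, h1, fun a ha => ?_, fun u a ha hE => ?_⟩
    · have := (h2 a ha).2
      rwa [initial_real, initial_real] at this
    · obtain ⟨b, hb, hub⟩ := h3 u u.isLt a ha ((initial_adj I u a).2 hE)
      exact ⟨⟨b, (h2 b hb).1⟩, hb, mem_edgesOfMate.2 hub⟩

/-- The jobs that are marked in an array. -/
def marked (m : ℕ) (rem : ℕ → ℕ) : Finset (Fin m) :=
  Finset.univ.filter fun u => rem u = 1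

/-- The program counts all remaining jobs that are reached; these are critical by `hrem`, so the
restriction of `coverSet` to critical jobs costs nothing. -/
theorem coverCount_eq (hM : IsMatching (initial I).Adj m n mate fun _ => True)
    (hperf : IsUPerfectMatching I.E (edgesOfMate m n mate)) {rem : ℕ → ℕ}
    (hrem : marked m rem ⊆ I.criticalJobs (edgesOfMate m n mate)) {w : Fin n}
    (hw : w ∉ matchedMachines (edgesOfMate m n mate)) :
    coverCount (initial I).Adj m mate rem w =
      (I.coverSet (edgesOfMate m n mate) w ∩ marked m rem).card := by
  classical
  rw [coverCount]
  symm
  refine Finset.card_bij (fun u _ => u.val) (fun u hu => ?_) (fun u _ v _ h => Fin.ext h)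
    (fun u hu => ?_)
  · rw [Finset.mem_inter, mem_coverSet_iff hw hperf] at hu
    rw [Finset.mem_filter, Finset.mem_range, reach_iff_altReach hM]
    exact ⟨u.isLt, hu.1.2, (Finset.mem_filter.1 hu.2).2⟩
  · rw [Finset.mem_filter, Finset.mem_range] at hu
    obtain ⟨h1, h2, h3⟩ := hu
    have hm : (⟨u, h1⟩ : Fin m) ∈ marked m rem := Finset.mem_filter.2 ⟨Finset.mem_univ _, h3⟩
    refine ⟨⟨u, h1⟩, ?_, rfl⟩
    rw [Finset.mem_inter, mem_coverSet_iff hw hperf]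
    exact ⟨⟨hrem hm, (reach_iff_altReach hM ⟨u, h1⟩ w).1 h2⟩, hm⟩

/-- The assertion after `k` steps of the greedy algorithm: a run on the remaining jobs `rem` extends
to a run on all critical jobs; `out` marks the machines selected so far. -/
def CoverInv (I : VRAP (Fin m) (Fin n)) (M : Finset (Fin m × Fin n)) (k : ℕ) (out rem : ℕ → ℕ) :
    Prop :=
  marked m rem ⊆ I.criticalJobs M ∧ (marked m rem).card + k ≤ m ∧
    ∃ D : Finset (Fin n), (∀ w : Fin n, out w = 1 ↔ w ∈ matchedMachines M ∪ D) ∧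
      (∀ w ∈ D, Disjoint (I.coverSet M w) (marked m rem)) ∧
      ∀ D', GreedyRun (I.coverSet M) I.c (Finset.univ \ matchedMachines M) (marked m rem) D' →
        GreedyRun (I.coverSet M) I.c (Finset.univ \ matchedMachines M) (I.criticalJobs M) (D ∪ D')

/-- By feasibility every remaining job is covered by some machine outside `W^M`. If no unused
machine covers any, and used ones are disjoint from the remaining jobs, none remains; further rounds
are idle. -/
theorem CoverInv.of_exhausted {M : Finset (Fin m × Fin n)} {k : ℕ} {out rem out' rem' : ℕ → ℕ}
    (h : CoverInv I M k out rem) (hk : k < m) (hI : I.Feasible) (hM : IsUPerfectMatching I.E M)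
    (hnone : ∀ w : Fin n, out w ≠ 1 → (I.coverSet M w ∩ marked m rem).card = 0)
    (hout : out' = out) (hrem : rem' = rem) : CoverInv I M (k + 1) out' rem' := by
  subst hout hrem
  obtain ⟨h1, -, D, h3, h4, h5⟩ := h
  have hempty : marked m rem' = ∅ := by
    rw [Finset.eq_empty_iff_forall_notMem]
    intro u hu
    obtain ⟨Y, hY⟩ := hI
    obtain ⟨w, hw, huw⟩ := exists_cover hY hM (h1 hu)
    by_cases hwD : w ∈ D
    · exact Finset.disjoint_left.1 (h4 w hwD) huw hu
    · have := hnone w (by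
        rw [ne_eq, h3, Finset.mem_union]
        rintro (h | h)
        · exact (Finset.mem_sdiff.1 hw).2 h
        · exact hwD h)
      rw [Finset.card_eq_zero] at this
      exact Finset.notMem_empty u (this ▸ Finset.mem_inter.2 ⟨huw, hu⟩)
  refine ⟨h1, ?_, D, h3, h4, h5⟩
  rw [hempty, Finset.card_empty]
  omega

/-- The program finds the selections in order, whereas `GreedyRun` is built from its end. This is
why the invariant speaks of extending runs on the remainder. At least one job is covered, which
keeps the bound on the remaining jobs. -/
theorem CoverInv.step {M : Finset (Fin m × Fin n)} {k : ℕ} {out rem out' rem' : ℕ → ℕ}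
    (h : CoverInv I M k out rem) (w : Fin n) (hw : out w ≠ 1)
    (hpos : 0 < (I.coverSet M w ∩ marked m rem).card)
    (hmin : ∀ y : Fin n, out y ≠ 1 → 0 < (I.coverSet M y ∩ marked m rem).card →
      (I.coverSet M y ∩ marked m rem).card * I.c w ≤ (I.coverSet M w ∩ marked m rem).card * I.c y)
    (hout : out' = Function.update out w 1)
    (hrem : marked m rem' = marked m rem \ I.coverSet M w) :
    CoverInv I M (k + 1) out' rem' := by
  obtain ⟨h1, h2, D, h3, h4, h5⟩ := h
  have hsub : marked m rem' ⊆ marked m rem := hrem ▸ Finset.sdiff_subset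
  refine ⟨hsub.trans h1, ?_, insert w D, fun y => ?_, fun y hy => ?_, fun D' hD' => ?_⟩
  · have := Finset.card_sdiff_add_card_inter (marked m rem) (I.coverSet M w)
    rw [← hrem, Finset.inter_comm] at this
    omega
  · rw [hout]
    by_cases hyw : y = w
    · simp [hyw]
    · rw [Function.update_of_ne (fun h => hyw (Fin.ext h)), h3]
      simp [hyw]
  · rcases Finset.mem_insert.1 hy with rfl | hy
    · rw [hrem]
      exact Finset.disjoint_sdiff
    · exact (h4 y hy).mono_right hsub
  -- The machine `w` becomes the first choice of the remaining run.
  · rw [Finset.insert_union, ← Finset.union_insert]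
    refine h5 _ (.step _ _ w ?_ (Finset.card_pos.1 hpos) (fun y hy hne => ?_) (hrem ▸ hD'))
    · rw [Finset.mem_sdiff]
      exact ⟨Finset.mem_univ _, fun h => hw ((h3 w).2 (Finset.mem_union_left _ h))⟩
    · have hpos' : (0 : ℝ) < (I.coverSet M w ∩ marked m rem).card := by exact_mod_cast hpos
      have hne' : (0 : ℝ) < (I.coverSet M y ∩ marked m rem).card := by exact_mod_cast hne.card_pos
      rw [div_le_div_iff₀ hpos' hne', mul_comm, mul_comm (I.c y)]
      refine hmin y (fun ho => ?_) hne.card_pos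
      -- `GreedyRun` demands minimality over all machines outside `W^M`, the program checks only
      -- unused ones. A used machine covers no remaining job and so is no competitor.
      rcases Finset.mem_union.1 ((h3 y).1 ho) with h | h
      · exact (Finset.mem_sdiff.1 hy).2 h
      · obtain ⟨u, hu⟩ := hne
        rw [Finset.mem_inter] at hu
        exact Finset.disjoint_left.1 (h4 y h) hu.1 hu.2

namespace Prog

/-- After the `m` cover rounds the bound in `CoverInv` leaves no remaining job, so the trivial run
on the empty set extends to a full greedy run with the selected machines. -/
theorem den_robustAssignment (hF : I.F.Nonempty) (hI : I.Feasible) :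
    I.AlgorithmOutput (output n (robustAssignment.den (initial I))) := by
  have hf1 := minCostMatching.frame (initial I)
  obtain ⟨hinv, hproc⟩ := den_minCostMatching (s := initial I)
    (initial_col I (by norm_num)) (initial_col I (by norm_num)) (initial_col I (by norm_num))
  rw [robustAssignment, den_seq, den_seq]
  generalize minCostMatching.den (initial I) = s₁ at hf1 hinv hproc
  rw [initial_jobs, initial_machines] at hinv
  rw [initial_machines] at hproc
  have hmin : I.IsMinCostMatching (edgesOfMate m n (s₁.col 5)) := by
    obtain ⟨Y, hY⟩ := hI
    obtain ⟨f, hf⟩ := hF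
    obtain ⟨g, hg, hgE, -⟩ := hY.exists_avoiding hf
    exact (hinv.isLocallyOptimal hproc).isMinCostMatching hg hgE
  have hf2 := initRemaining.frame s₁
  have hrem := den_initRemaining (s := s₁) fun u => by
    rw [hf1.col 9 (by decide), initial_col I (by norm_num)]
  generalize initRemaining.den s₁ = s₂ at hf2 hrem
  rw [hf1.nat 0 (by decide), initial_jobs, hf1.col 3 (by decide)] at hrem
  have h4 : s₂.col 4 = s₁.col 4 := hf2.col 4 (by decide)
  have h5 : s₂.col 5 = s₁.col 5 := hf2.col 5 (by decide)
  have h0 : s₂.nat 0 = (initial I).nat 0 := (hf2.nat 0 (by decide)).trans (hf1.nat 0 (by decide))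
  have h1 : s₂.nat 1 = (initial I).nat 1 := (hf2.nat 1 (by decide)).trans (hf1.nat 1 (by decide))
  have hA : s₂.Adj = (initial I).Adj := (hf2.adj (by decide)).trans (hf1.adj (by decide))
  have hr : s₂.real 0 = (initial I).real 0 :=
    (hf2.real 0 (by decide)).trans (hf1.real 0 (by decide))
  set M := edgesOfMate m n (s₁.col 5) with hMdef
  have hcrit : marked m (s₂.col 9) = I.criticalJobs M := by
    ext u
    obtain ⟨⟨v, x⟩, he, hv⟩ := hmin.1.2.2 u
    change v = u at hv
    subst hv
    have hx := mem_edgesOfMate.1 he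
    simp only [marked, criticalJobs, Finset.mem_filter, Finset.mem_univ, true_and,
      hrem v v.isLt, hMdef, mem_edgesOfMate, hx, Nat.add_sub_cancel, initial_col_three]
    refine ⟨fun hxF => ⟨x, hxF, rfl⟩, ?_⟩
    rintro ⟨f, hf, hxf⟩
    rwa [show x = f from Fin.ext (by omega)]
  have hmatched : ∀ w : Fin n, s₁.col 4 w = 1 ↔ w ∈ matchedMachines M := by
    intro w
    rw [hinv.out_iff w w.isLt, matchedMachines, Finset.mem_image]
    constructor
    · rintro ⟨u, hu, huw⟩
      exact ⟨(⟨u, hu⟩, w), mem_edgesOfMate.2 huw, rfl⟩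
    · rintro ⟨⟨u, x⟩, he, hxw⟩
      change x = w at hxw
      subst hxw
      exact ⟨u, u.isLt, mem_edgesOfMate.1 he⟩
  have H := den_forTo (v := 21) (a := 0) (s := s₂) (p := coverRound) (by decide)
    (fun k s' => CoverInv I M k (s'.col 4) (s'.col 9)) ?_ ?_ ?_
  · rw [h0, initial_jobs] at H
    obtain ⟨-, hcard, D, hD, -, hrun⟩ := H
    have hempty : marked m (((forTo 21 0 coverRound).den s₂).col 9) = ∅ :=
      Finset.card_eq_zero.1 (by omega)
    refine ⟨M, D, hmin, ?_, ?_⟩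
    · have := hrun ∅ (hempty ▸ .done)
      rwa [Finset.union_empty] at this
    · ext w
      rw [← hD w]
      simp [output, State.col]
  · intro k s' j h
    rwa [State.col_writeNat_of_ne _ _ _ _ (by decide), State.col_writeNat_of_ne _ _ _ _ (by decide)]
  · refine ⟨hcrit.subset, ?_, ∅, fun w => ?_, by simp, fun D' hD' => ?_⟩
    · simpa using Finset.card_le_univ (marked m (s₂.col 9))
    · rw [h4, hmatched, Finset.union_empty]
    · rw [hcrit] at hD'
      rwa [Finset.empty_union]
  · rintro k hk s' hf - hinvk
    rw [h0, initial_jobs] at hk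
    have hround := den_coverRound s'
    rw [hf.nat 0 (by decide), hf.nat 1 (by decide), h0, h1, initial_jobs, initial_machines,
      hf.adj (by decide), hA, hf.col 5 (by decide), h5, hf.real 0 (by decide), hr] at hround
    have hcount : ∀ w : Fin n, s'.col 4 w ≠ 1 →
        coverCount (initial I).Adj m (s₁.col 5) (s'.col 9) w =
          (I.coverSet M w ∩ marked m (s'.col 9)).card := by
      intro w hw
      obtain ⟨hsub, -, D, hD, -⟩ := hinvk
      exact coverCount_eq hinv.matching hmin.1 hsub
        fun h => hw ((hD w).2 (Finset.mem_union_left _ h))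
    rcases hround with ⟨e4, e9, hnone⟩ | ⟨w, hw, hw4, hpos, hminw, e4, e9⟩
    · exact hinvk.of_exhausted hk hI hmin.1
        (fun w hw => (hcount w hw).symm.trans (hnone w w.isLt hw)) e4 e9
    · have hfree : (⟨w, hw⟩ : Fin n) ∉ matchedMachines M := by
        obtain ⟨-, -, D, hD, -⟩ := hinvk
        exact fun h => hw4 ((hD ⟨w, hw⟩).2 (Finset.mem_union_left _ h))
      refine hinvk.step ⟨w, hw⟩ hw4 ?_ (fun y hy hyp => ?_) e4 ?_
      · rwa [← hcount ⟨w, hw⟩ hw4]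
      · rw [← hcount y hy] at hyp ⊢
        rw [← hcount ⟨w, hw⟩ hw4, ← initial_real, ← initial_real]
        exact hminw y y.isLt hy hyp
      · ext u
        have hsub := hinvk.1
        rw [Finset.mem_sdiff, mem_coverSet_iff hfree hmin.1, ← reach_iff_altReach hinv.matching]
        simp only [marked, Finset.mem_filter, Finset.mem_univ, true_and, e9 u u.isLt]
        refine and_congr_right fun hu => not_congr ⟨fun h => ⟨hsub ?_, h⟩, fun h => h.2⟩
        exact Finset.mem_filter.2 ⟨Finset.mem_univ _, hu⟩

end Prog

end Instance

end RAM

/-- The first part is the approximation guarantee, for all results that the algorithm can return;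
the second part says that one fixed program carries out the algorithm in polynomial time. -/
theorem mainTheorem3 :
    (∀ (U W : Type*) [Fintype U] [Fintype W] [DecidableEq U] [DecidableEq W] (I : VRAP U W),
      I.F.Nonempty → I.Feasible →
        (∃ X, I.AlgorithmOutput X) ∧
        ∀ X, I.AlgorithmOutput X →
          I.NodeRobust X ∧
          ∀ Y, I.NodeRobust Y → I.cost X ≤ (Real.log (Fintype.card U) + 2) * I.cost Y) ∧
    ∃ (P : RAM.Cmd) (p : Polynomial ℕ), ∀ (m n : ℕ) (I : VRAP (Fin m) (Fin n)),
      I.F.Nonempty → I.Feasible →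
        ∃ (t : ℕ) (s : RAM.State), RAM.Exec P (RAM.initial I) t s ∧
          t ≤ p.eval (m + n) ∧ I.AlgorithmOutput (RAM.output n s) := by
  refine ⟨fun U W _ _ _ _ I hF hI => ⟨VRAP.exists_algorithmOutput hF hI, fun X hX =>
    ⟨hX.nodeRobust, fun Y hY => hX.cost_le hF hY⟩⟩,
    RAM.Prog.robustAssignment.toCmd, RAM.Prog.robustAssignment.timeBound,
    fun m n I hF hI => ?_⟩
  -- Both loop bounds, `m` and `n`, are at most `m + n`; well-formedness is a decidable property of
  -- the program text.
  obtain ⟨t, ht, hexec⟩ := RAM.Prog.exec (p := RAM.Prog.robustAssignment) (N := m + n) (by decide)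
    (s := RAM.initial I) (by simp) (by simp)
  exact ⟨t, _, hexec, ht, RAM.Prog.den_robustAssignment hF hI⟩
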